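/- **Theorem 4.1 (Perron's method).** Let $M$ be a connected, complete, finite-dimensional smooth Riemannian manifold (without boundary) with Riemannian distance $d$, $\Omega\subset M$ open and bounded, $T>0$, $h\in C([0,T)\times\overline\Omega)$ and $\psi\in C(\overline\Omega)$. Let $\mathcal L^2_s(TM_x)$ be the space of symmetric bilinear forms on $TM_x$ and let $F(t,x,r,\zeta,A)$ be a continuous real function of $t\in[0,T]$, $x\in M$, $r\in\mathbb R$, $\zeta\in TM_x^*$, $A\in\mathcal L^2_s(TM_x)$. Assume that $F$ is proper for each $t\in(0,T)$: $F(t,x,r,\zeta,Q)\le F(t,x,r,\zeta,P)$ whenever $P\le Q$, and $F(t,x,r,\zeta,A)\le F(t,x,s,\zeta,A)$ whenever $r\le s$. Consider the Cauchy–Dirichlet problem $$(1.1)\qquad\begin{cases}u_t+F(t,x,u,du,d^2u)=0&\text{in }(0,T)\times\Omega,\\ u(t,x)=h(t,x)&\text{for }(t,x)\in[0,T)\times\partial\Omega,\\ u(0,x)=\psi(x)&\text{for }x\in\overline\Omega,\end{cases}$$ where $du$ and $d^2u$ are the differential and the Riemannian Hessian in $x$. For $(t,x)\in(0,T)\times\Omega$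 let $\mathcal P^{2,+}u(t,x)$ (resp. $\mathcal P^{2,-}u(t,x)$) be the set of triples $(\varphi_t,d\varphi,d^2\varphi)(t,x)$, where $\varphi$ is of class $C^{1,2}$ near $(t,x)$ and $u-\varphi$ attains a local maximum (resp. minimum) $0$ at $(t,x)$. A *subsolution* (resp. *supersolution*) of (1.1) is an upper (resp. lower) semicontinuous function $u:[0,T)\times\overline\Omega\to\mathbb R$ such that $u\le h$ (resp. $\ge$) on $[0,T)\times\partial\Omega$, $u(0,\cdot)\le\psi$ (resp. $\ge$) on $\overline\Omega$, and $p+F(t,x,u(t,x),\zeta,A)\le 0$ (resp. $\ge0$) for all $(t,x)\in(0,T)\times\Omega$ and all $(p,\zeta,A)\in\mathcal P^{2,+}u(t,x)$ (resp. $\mathcal P^{2,-}u(t,x)$). A *solution* is a function that is both a subsolution and a supersolution. For $u:[0,T)\times\overline\Omega\to\mathbb R$ put $$u^*(t,x)=\lim_{r\downarrow0}\sup\{u(s,y):(s,y)\in[0,T)\times\overline\Omega,\ |s-t|\le r,\ d(y,x)\le r\},$$ $$u_*(t,x)=\lim_{r\downarrow0}\inf\{u(s,y):(s,y)\in[0,T)\times\overline\Omega,\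 |s-t|\le r,\ d(y,x)\le r\},$$ with values in $[-\infty,+\infty]$. Assume that comparison holds for (1.1): if $w$ is a subsolution and $v$ a supersolution of (1.1), then $w\le v$ on $[0,T)\times\overline\Omega$. Suppose also that there are a subsolution $\underline u$ and a supersolution $\bar u$ of (1.1) with $$\underline u_*(0,x)=\bar u^*(0,x)=\psi(x)\quad(x\in\overline\Omega),\qquad \underline u_*(t,x)=\bar u^*(t,x)=h(t,x)\quad((t,x)\in[0,T)\times\partial\Omega).$$ Then the supremum $$W(t,x)=\sup\{w(t,x):\ w\text{ is a subsolution of (1.1) and }\underline u\le w\le\bar u\text{ on }[0,T)\times\overline\Omega\}$$ is that of a nonempty set bounded above for every $(t,x)\in[0,T)\times\overline\Omega$, and $W$ is a solution of (1.1). -/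

import Mathlib

open Set Filter Topology Manifold Bundle
open scoped ContDiff

-- So that `EuclideanSpace ℝ (Fin n)` carries its standard `chartedSpaceSelf` structure.
attribute [-instance] TopCat.of.chartedSpace

noncomputable section

namespace ParabolicViscosity

section Riemannian

variable {n : ℕ} {M : Type*} [MetricSpace M] [ChartedSpace (EuclideanSpace ℝ (Fin n)) M]
  [IsManifold (𝓡 n) ∞ M] [RiemannianBundle (fun x : M => TangentSpace (𝓡 n) x)]

/-- The covectors at `x`, i.e. the elements of `T*M_x`. -/
abbrev Covector (n : ℕ) {M : Type*} [TopologicalSpace M]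
    [ChartedSpace (EuclideanSpace ℝ (Fin n)) M] (x : M) : Type :=
  TangentSpace (𝓡 n) x →L[ℝ] ℝ

/-- The bilinear forms on the tangent space at `x`. -/
abbrev BilinForm (n : ℕ) {M : Type*} [TopologicalSpace M]
    [ChartedSpace (EuclideanSpace ℝ (Fin n)) M] (x : M) : Type :=
  TangentSpace (𝓡 n) x →L[ℝ] TangentSpace (𝓡 n) x →L[ℝ] ℝ

/-- The coefficients `g_v(a, b)` of the Riemannian metric in the chart at `c`: the inner product
of the images of `a` and `b` under the differential of the inverse chart at `v`. -/
def chartMetric (c : M) (v a b : EuclideanSpace ℝ (Fin n)) : ℝ :=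
  inner ℝ
    (mfderiv 𝓘(ℝ, EuclideanSpace ℝ (Fin n)) (𝓡 n) (extChartAt (𝓡 n) c).symm v a :
      TangentSpace (𝓡 n) ((extChartAt (𝓡 n) c).symm v))
    (mfderiv 𝓘(ℝ, EuclideanSpace ℝ (Fin n)) (𝓡 n) (extChartAt (𝓡 n) c).symm v b :
      TangentSpace (𝓡 n) ((extChartAt (𝓡 n) c).symm v))

/-- The matrix `(g_ij)` of the metric in the chart at `c`. -/
def chartMetricMatrix (c : M) (v : EuclideanSpace ℝ (Fin n)) : Matrix (Fin n) (Fin n) ℝ :=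
  fun i j => chartMetric c v (EuclideanSpace.single i 1) (EuclideanSpace.single j 1)

/-- The Christoffel symbols of the first kind
`1/2 (∂_a g(b, d) + ∂_b g(a, d) - ∂_d g(a, b))` in the chart at `c`. -/
def christoffelFirst (c : M) (v a b d : EuclideanSpace ℝ (Fin n)) : ℝ :=
  (1 / 2 : ℝ) *
    (fderiv ℝ (fun w => chartMetric c w b d) v a
      + fderiv ℝ (fun w => chartMetric c w a d) v b
      - fderiv ℝ (fun w => chartMetric c w a b) v d)

/-- The Christoffel symbols of the Levi-Civita connection in the chart at `c`, as a vector
depending on two vectors: its `k`-th component is `∑ l, g^{kl} Γ_l(a, b)`, with `g^{kl}` the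
inverse matrix of `g_{kl}`. -/
def christoffel (c : M) (v a b : EuclideanSpace ℝ (Fin n)) : EuclideanSpace ℝ (Fin n) :=
  WithLp.toLp 2 (Matrix.mulVec (chartMetricMatrix c v)⁻¹
    (fun l => christoffelFirst c v a b (EuclideanSpace.single l 1)))

/-- The Riemannian Hessian of `f` at `x` computed in the chart at `c`:
`D²f(a, b) - Df(Γ(a, b))`, where `a`, `b` are the coordinates of `X`, `Y`. -/
def hessianInChart (c : M) (f : M → ℝ) (x : M) (X Y : TangentSpace (𝓡 n) x) : ℝ :=
  let χ := extChartAt (𝓡 n) c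
  let g : EuclideanSpace ℝ (Fin n) → ℝ := fun v => f (χ.symm v)
  let a : EuclideanSpace ℝ (Fin n) := mfderiv (𝓡 n) 𝓘(ℝ, EuclideanSpace ℝ (Fin n)) χ x X
  let b : EuclideanSpace ℝ (Fin n) := mfderiv (𝓡 n) 𝓘(ℝ, EuclideanSpace ℝ (Fin n)) χ x Y
  fderiv ℝ (fderiv ℝ g) (χ x) a b - fderiv ℝ g (χ x) (christoffel c (χ x) a b)

/-- The Hessian `d²f(X, Y)` for the Levi-Civita connection, computed in the preferred chart
at `x` (for `f` of class `C²` the result does not depend on the chart). -/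
def hessian (f : M → ℝ) (x : M) (X Y : TangentSpace (𝓡 n) x) : ℝ :=
  hessianInChart x f x X Y

end Riemannian

section Jets

variable {M : Type*} [MetricSpace M]

/-- `φ` is of class `C^{1,2}` on the open set `U` of `ℝ × M`: read in any of the preferred charts,
it is continuous, and its first time derivative and its first and second space derivatives
exist and are continuous functions of `(t, x)`. -/
def IsC12On (n : ℕ) [ChartedSpace (EuclideanSpace ℝ (Fin n)) M]
    (φ : ℝ → M → ℝ) (U : Set (ℝ × M)) : Prop :=
  ∀ c : M,
    let χ := extChartAt (𝓡 n) c
    let V : Set (ℝ × EuclideanSpace ℝ (Fin n)) :=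
      {q | q.2 ∈ χ.target ∧ (q.1, χ.symm q.2) ∈ U}
    let g : ℝ → EuclideanSpace ℝ (Fin n) → ℝ := fun s v => φ s (χ.symm v)
    (∀ q ∈ V, DifferentiableAt ℝ (fun s => g s q.2) q.1 ∧ DifferentiableAt ℝ (g q.1) q.2 ∧
      DifferentiableAt ℝ (fderiv ℝ (g q.1)) q.2) ∧
    ContinuousOn (fun q : ℝ × EuclideanSpace ℝ (Fin n) => g q.1 q.2) V ∧
    ContinuousOn (fun q : ℝ × EuclideanSpace ℝ (Fin n) => deriv (fun s => g s q.2) q.1) V ∧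
    ContinuousOn (fun q : ℝ × EuclideanSpace ℝ (Fin n) => fderiv ℝ (g q.1) q.2) V ∧
    ContinuousOn (fun q : ℝ × EuclideanSpace ℝ (Fin n) => fderiv ℝ (fderiv ℝ (g q.1)) q.2) V

variable {n : ℕ} [ChartedSpace (EuclideanSpace ℝ (Fin n)) M]
  [IsManifold (𝓡 n) ∞ M] [RiemannianBundle (fun x : M => TangentSpace (𝓡 n) x)]

/-- `(p, ζ, A)` is the triple `(φ_t, dφ, d²φ)` at `(t, x)`. -/
def IsJetOf (φ : ℝ → M → ℝ) (t : ℝ) (x : M) (p : ℝ) (ζ : Covector n x) (A : BilinForm n x) :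
    Prop :=
  p = deriv (fun s => φ s x) t ∧ ζ = mvfderiv (𝓡 n) (φ t) x ∧
    ∀ X Y : TangentSpace (𝓡 n) x, A X Y = hessian (φ t) x X Y

/-- The second order parabolic superjet `P^{2,+} f(t, x)`: the triples `(φ_t, dφ, d²φ)(t, x)` of
the functions `φ` of class `C^{1,2}` for which `f - φ` attains a local maximum `0` at `(t, x)`.
Only the germ of `φ` at `(t, x)` matters, so `φ` is required to be `C^{1,2}` near `(t, x)`; by
cutting off one obtains the same triples from globally defined `φ`. -/
def superjet (n : ℕ) [ChartedSpace (EuclideanSpace ℝ (Fin n)) M]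
    [IsManifold (𝓡 n) ∞ M] [RiemannianBundle (fun x : M => TangentSpace (𝓡 n) x)]
    (f : ℝ → M → ℝ) (t : ℝ) (x : M) : Set (ℝ × Covector n x × BilinForm n x) :=
  {j | ∃ (φ : ℝ → M → ℝ) (U : Set (ℝ × M)), IsOpen U ∧ (t, x) ∈ U ∧ IsC12On n φ U ∧
    f t x = φ t x ∧ (∀ᶠ q : ℝ × M in 𝓝 (t, x), f q.1 q.2 ≤ φ q.1 q.2) ∧
    IsJetOf φ t x j.1 j.2.1 j.2.2}

/-- The second order parabolic subjet `P^{2,-} f(t, x)`: as the superjet, with a local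
minimum `0` of `f - φ` at `(t, x)`. -/
def subjet (n : ℕ) [ChartedSpace (EuclideanSpace ℝ (Fin n)) M]
    [IsManifold (𝓡 n) ∞ M] [RiemannianBundle (fun x : M => TangentSpace (𝓡 n) x)]
    (f : ℝ → M → ℝ) (t : ℝ) (x : M) : Set (ℝ × Covector n x × BilinForm n x) :=
  {j | ∃ (φ : ℝ → M → ℝ) (U : Set (ℝ × M)), IsOpen U ∧ (t, x) ∈ U ∧ IsC12On n φ U ∧
    f t x = φ t x ∧ (∀ᶠ q : ℝ × M in 𝓝 (t, x), φ q.1 q.2 ≤ f q.1 q.2) ∧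
    IsJetOf φ t x j.1 j.2.1 j.2.2}

end Jets

section Nonlinearity

/-- The type of the nonlinearity `F(t, x, r, ζ, A)`; only its values for `t ∈ [0, T]` and
symmetric `A` are ever used. -/
abbrev Nonlinearity (n : ℕ) (M : Type*) [TopologicalSpace M]
    [ChartedSpace (EuclideanSpace ℝ (Fin n)) M] : Type _ :=
  ℝ → (x : M) → ℝ → Covector n x → BilinForm n x → ℝ

variable {n : ℕ} {M : Type*} [TopologicalSpace M]
  [ChartedSpace (EuclideanSpace ℝ (Fin n)) M]

/-- Symmetry of a bilinear form on a tangent space. -/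
def IsSymmForm {x : M} (A : BilinForm n x) : Prop :=
  ∀ X Y : TangentSpace (𝓡 n) x, A X Y = A Y X

/-- The total space of the vector bundle `T*M ⊕ (T*M ⊗ T*M)` over `M`. -/
abbrev CoJetBundle (n : ℕ) (M : Type*) [TopologicalSpace M]
    [ChartedSpace (EuclideanSpace ℝ (Fin n)) M] : Type _ :=
  TotalSpace ((EuclideanSpace ℝ (Fin n) →L[ℝ] ℝ) ×
      (EuclideanSpace ℝ (Fin n) →L[ℝ] EuclideanSpace ℝ (Fin n) →L[ℝ] ℝ))
    ((fun x : M => Covector n x) ×ᵇ (fun x : M => BilinForm n x))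

/-- `F` is continuous on `χ`, the set of all `(t, x, r, ζ, A)` with `t ∈ [0, T]`, `r` real,
`ζ` a covector and `A` a symmetric bilinear form at `x`, for the vector bundle topology. -/
def IsContinuousNonlinearity [IsManifold (𝓡 n) ∞ M] (T : ℝ) (F : Nonlinearity n M) : Prop :=
  ContinuousOn
    (fun q : ℝ × ℝ × CoJetBundle n M => F q.1 q.2.2.proj q.2.1 q.2.2.snd.1 q.2.2.snd.2)
    {q | q.1 ∈ Icc 0 T ∧ IsSymmForm q.2.2.snd.2}

/-- Degenerate ellipticity of `F(t, ·)` for each `t ∈ (0, T)`. -/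
def IsDegenerateElliptic (T : ℝ) (F : Nonlinearity n M) : Prop :=
  ∀ t ∈ Ioo 0 T, ∀ (x : M) (r : ℝ) (ζ : Covector n x) (P Q : BilinForm n x),
    IsSymmForm P → IsSymmForm Q → (∀ X : TangentSpace (𝓡 n) x, P X X ≤ Q X X) →
      F t x r ζ Q ≤ F t x r ζ P

/-- Properness of `F(t, ·)` for each `t ∈ (0, T)`: degenerate ellipticity, and `F` is
nondecreasing in `r`. -/
def IsProperNonlinearity (T : ℝ) (F : Nonlinearity n M) : Prop :=
  IsDegenerateElliptic T F ∧
  ∀ t ∈ Ioo 0 T, ∀ (x : M) (ζ : Covector n x) (A : BilinForm n x), IsSymmForm A →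
    ∀ r s : ℝ, r ≤ s → F t x r ζ A ≤ F t x s ζ A

end Nonlinearity

section Solutions

variable {n : ℕ} {M : Type*} [MetricSpace M] [ChartedSpace (EuclideanSpace ℝ (Fin n)) M]
  [IsManifold (𝓡 n) ∞ M] [RiemannianBundle (fun x : M => TangentSpace (𝓡 n) x)]

/-- The set `[0, T) × closure Ω` on which the unknown functions live. Functions on it are
represented by functions `ℝ → M → ℝ` whose values elsewhere play no role. -/
def spaceTime {M : Type*} [TopologicalSpace M] (T : ℝ) (Ω : Set M) : Set (ℝ × M) :=
  Ico 0 T ×ˢ closure Ω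

/-- Viscosity subsolutions of `u_t + F(t, x, u, du, d²u) = 0` in `(0, T) × Ω` with boundary
data `h` and initial data `ψ`. -/
structure IsViscositySubsolution (T : ℝ) (Ω : Set M) (F : Nonlinearity n M)
    (h : ℝ → M → ℝ) (ψ : M → ℝ) (u : ℝ → M → ℝ) : Prop where
  usc : UpperSemicontinuousOn (fun q : ℝ × M => u q.1 q.2) (spaceTime T Ω)
  boundary : ∀ t ∈ Ico 0 T, ∀ x ∈ frontier Ω, u t x ≤ h t x
  initial : ∀ x ∈ closure Ω, u 0 x ≤ ψ x
  equation : ∀ t ∈ Ioo 0 T, ∀ x ∈ Ω, ∀ j ∈ superjet n u t x,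
    j.1 + F t x (u t x) j.2.1 j.2.2 ≤ 0

/-- Viscosity supersolutions of `u_t + F(t, x, u, du, d²u) = 0` in `(0, T) × Ω` with boundary
data `h` and initial data `ψ`. -/
structure IsViscositySupersolution (T : ℝ) (Ω : Set M) (F : Nonlinearity n M)
    (h : ℝ → M → ℝ) (ψ : M → ℝ) (u : ℝ → M → ℝ) : Prop where
  lsc : LowerSemicontinuousOn (fun q : ℝ × M => u q.1 q.2) (spaceTime T Ω)
  boundary : ∀ t ∈ Ico 0 T, ∀ x ∈ frontier Ω, h t x ≤ u t x
  initial : ∀ x ∈ closure Ω, ψ x ≤ u 0 x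
  equation : ∀ t ∈ Ioo 0 T, ∀ x ∈ Ω, ∀ j ∈ subjet n u t x,
    0 ≤ j.1 + F t x (u t x) j.2.1 j.2.2

/-- Viscosity solutions: both a subsolution and a supersolution. -/
def IsViscositySolution (T : ℝ) (Ω : Set M) (F : Nonlinearity n M)
    (h : ℝ → M → ℝ) (ψ : M → ℝ) (u : ℝ → M → ℝ) : Prop :=
  IsViscositySubsolution T Ω F h ψ u ∧ IsViscositySupersolution T Ω F h ψ u

/-- Comparison: every subsolution lies below every supersolution. -/
def ComparisonHolds (T : ℝ) (Ω : Set M) (F : Nonlinearity n M)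
    (h : ℝ → M → ℝ) (ψ : M → ℝ) : Prop :=
  ∀ w v : ℝ → M → ℝ, IsViscositySubsolution T Ω F h ψ w → IsViscositySupersolution T Ω F h ψ v →
    ∀ q ∈ spaceTime T Ω, w q.1 q.2 ≤ v q.1 q.2

/-- The upper semicontinuous envelope `u^*(t, x)` of a function on `D`: the limit (i.e. the
infimum) as `r ↓ 0` of the supremum of `u` over the points of `D` within `r` of `(t, x)`. -/
def upperEnvelope {M : Type*} [MetricSpace M] (D : Set (ℝ × M)) (u : ℝ → M → ℝ)
    (t : ℝ) (x : M) : EReal :=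
  ⨅ (r : ℝ) (_ : 0 < r),
    ⨆ (q : ℝ × M) (_ : q ∈ D ∧ |q.1 - t| ≤ r ∧ dist q.2 x ≤ r), (u q.1 q.2 : EReal)

/-- The lower semicontinuous envelope `u_*(t, x)` of a function on `D`. -/
def lowerEnvelope {M : Type*} [MetricSpace M] (D : Set (ℝ × M)) (u : ℝ → M → ℝ)
    (t : ℝ) (x : M) : EReal :=
  ⨆ (r : ℝ) (_ : 0 < r),
    ⨅ (q : ℝ × M) (_ : q ∈ D ∧ |q.1 - t| ≤ r ∧ dist q.2 x ≤ r), (u q.1 q.2 : EReal)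

/-- The values at `(t, x)` of the subsolutions that lie between `uLow` and `uUp`. -/
def perronValues (T : ℝ) (Ω : Set M) (F : Nonlinearity n M) (h : ℝ → M → ℝ) (ψ : M → ℝ)
    (uLow uUp : ℝ → M → ℝ) (t : ℝ) (x : M) : Set ℝ :=
  {r | ∃ w : ℝ → M → ℝ, IsViscositySubsolution T Ω F h ψ w ∧
    (∀ q ∈ spaceTime T Ω, uLow q.1 q.2 ≤ w q.1 q.2 ∧ w q.1 q.2 ≤ uUp q.1 q.2) ∧ r = w t x}

/-- Perron's function `W`, the pointwise supremum of the subsolutions between `uLow`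
and `uUp`. -/
def perronFunction (T : ℝ) (Ω : Set M) (F : Nonlinearity n M) (h : ℝ → M → ℝ) (ψ : M → ℝ)
    (uLow uUp : ℝ → M → ℝ) (t : ℝ) (x : M) : ℝ :=
  sSup (perronValues T Ω F h ψ uLow uUp t x)

end Solutions

end ParabolicViscosity

end

/-!
Perron's method for viscosity solutions of a parabolic Cauchy-Dirichlet problem on a Riemannian
manifold.

Write `W` for Perron's function. The set defining it contains `uLow` and is bounded above by
`uUp`, which settles the first half. For the second half, both semicontinuous envelopes of `W` are
compared with `W` itself.

* *The upper envelope `Vu` of `W` is a subsolution.* If a test function `φ` touches `Vu` from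
  above at `z₀`, adding to it a multiple of `quartic`, that is `(s - t)² + |y - x|⁴` in a chart,
  makes the contact strict without changing the jet of `φ` at `z₀`. Then members of the family
  touch translates of the perturbed `φ` at points close to `z₀`, and the continuity of `F` passes
  their inequality to `z₀` (`chartOperator_le_of_isSup`). On the parabolic boundary `Vu ≤ uUp^*`,
  which equals the data. By comparison `Vu ≤ uUp`, so `Vu` is a member of the family: `Vu ≤ W`,
  and `W = Vu` is a subsolution.
* *The lower envelope `Vl` of `W` is a supersolution.* If a test function `φ` touches `Vl` from
  below at `z₀` and violates the inequality there, then `φ - quartic + δ` is a classical strict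
  subsolution close to `z₀` for small `δ`, it lies below `W` away from `z₀`, and it exceeds `W`
  somewhere. The maximum of the two is a subsolution exceeding `W` (`exists_subsolution_gt`); by
  comparison it lies below `uUp`, so that it is a member of the family, which is absurd.
* By comparison `W ≤ Vl`, so `W = Vl` is a supersolution too.

Three facts are needed to run this argument.

The envelopes have to be finite. Inside the cylinder nothing is assumed on the envelopes of `uLow`
and `uUp`, which may be infinite. But `closure Ω` is compact by the Hopf-Rinow theorem
(`properSpace_of_completeSpace`), so that `h` is bounded up to any time before `T`, and a function
of time alone that dominates the data and increases fast enough is a supersolution, its negative a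
subsolution (`exists_barrier`). By comparison with these, `W` is locally bounded.

The jets of a test function have to depend continuously on the point, whereas the Hessian at `x`
is defined in the preferred chart at `x`, which varies with `x` in no controlled way. The
transformation law of the Christoffel symbols (`christoffel_transition`) shows that the Hessian
may be computed in any chart around `x` (`hessianInChart_eq_hessianInChart`). In a fixed chart the
Christoffel symbols are continuous, and so is the map from coordinates to the bundle of jets on
which `F` is continuous (`continuousOn_coJetOfChart`). Hence `φ_t + F(t, x, r, dφ, d²φ)` is
continuous in `(t, x, r)` for a test function `φ` (`continuousOn_chartOperator`), and all
arguments use this coordinate expression, `chartOperator`.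

Ellipticity has to give that a smooth function touching another one from above has the smaller
value of the operator (`chartOperator_le_of_touching`). At the contact point the first derivatives
agree, so the terms with Christoffel symbols cancel in the difference of the two Hessians, and the
second order necessary condition in coordinates applies.
-/

set_option linter.unusedSectionVars false

noncomputable section

namespace ParabolicViscosity

/-! ### Hopf-Rinow: bounded closed sets are compact -/

section HopfRinow

variable {n : ℕ} {M : Type*} [MetricSpace M] [ChartedSpace (EuclideanSpace ℝ (Fin n)) M]
  [IsManifold (𝓡 n) ∞ M] [RiemannianBundle (fun x : M => TangentSpace (𝓡 n) x)]

/-- A Riemannian manifold is a length space: two points at distance less than `a + b` have a point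
within distance `a` of the first and within distance `b` of the second, namely a suitable point of a
nearly shortest path. -/
theorem exists_dist_le_dist_le [IsContMDiffRiemannianBundle (𝓡 n) ∞ (EuclideanSpace ℝ (Fin n))
      (fun x : M => TangentSpace (𝓡 n) x)] [IsRiemannianManifold (𝓡 n) M] {x y : M} {a b : ℝ}
    (ha : 0 ≤ a) (hb : 0 ≤ b) (h : dist x y < a + b) : ∃ z : M, dist x z ≤ a ∧ dist z y ≤ b := by
  rcases le_or_gt (dist x y) a with hxy | hxy
  · exact ⟨y, hxy, by simpa using hb⟩
  have hlt : riemannianEDist (𝓡 n) x y < ENNReal.ofReal (a + b) := by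
    rw [← IsRiemannianManifold.out (I := 𝓡 n) x y, edist_dist]
    exact (ENNReal.ofReal_lt_ofReal_iff (by linarith [dist_nonneg (x := x) (y := y)])).2 h
  obtain ⟨γ, h0, h1, hγ, hlen⟩ := exists_lt_of_riemannianEDist_lt hlt
  have hcont : ContinuousOn (fun t => dist x (γ t)) (Icc 0 1) :=
    continuous_const.dist continuous_id |>.comp_continuousOn hγ.continuousOn
  obtain ⟨t, ht, hta⟩ : a ∈ (fun t => dist x (γ t)) '' Icc 0 1 :=
    intermediate_value_Icc zero_le_one hcont ⟨by simpa [h0] using ha, by simpa [h1] using hxy.le⟩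
  refine ⟨γ t, hta.le, ?_⟩
  have e1 : edist x (γ t) ≤ pathELength (𝓡 n) γ 0 t := by
    rw [IsRiemannianManifold.out (I := 𝓡 n)]
    exact riemannianEDist_le_pathELength (hγ.mono (Icc_subset_Icc_right ht.2)) h0 rfl ht.1
  have e2 : edist (γ t) y ≤ pathELength (𝓡 n) γ t 1 := by
    rw [IsRiemannianManifold.out (I := 𝓡 n)]
    exact riemannianEDist_le_pathELength (hγ.mono (Icc_subset_Icc_left ht.1)) rfl h1 ht.2
  have e3 : edist x (γ t) + edist (γ t) y < ENNReal.ofReal (a + b) :=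
    ((add_le_add e1 e2).trans_eq (pathELength_add ht.1 ht.2)).trans_lt hlen
  rw [edist_dist, edist_dist, ← ENNReal.ofReal_add dist_nonneg dist_nonneg,
    ENNReal.ofReal_lt_ofReal_iff'] at e3
  have hta' : dist x (γ t) = a := hta
  linarith [e3.1]

end HopfRinow

/-- The Hopf-Rinow-Cohn-Vossen theorem: a complete and locally compact length space is proper. The
supremum of the radii of the compact closed balls around a point cannot be finite. -/
theorem properSpace_of_exists_dist_le {X : Type*} [MetricSpace X] [CompleteSpace X]
    [LocallyCompactSpace X]
    (hlen : ∀ (x y : X) (a b : ℝ), 0 ≤ a → 0 ≤ b → dist x y < a + b →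
      ∃ z, dist x z ≤ a ∧ dist z y ≤ b) : ProperSpace X := by
  refine ⟨fun x => ?_⟩
  by_contra! hex
  obtain ⟨r₀, hr₀⟩ := hex
  set S : Set ℝ := {r | 0 ≤ r ∧ IsCompact (Metric.closedBall x r)} with hS
  have hS0 : (0 : ℝ) ∈ S := ⟨le_rfl, by simp⟩
  have hmono : ∀ r ∈ S, ∀ s ≤ r, IsCompact (Metric.closedBall x s) := fun r hr s hs =>
    hr.2.of_isClosed_subset Metric.isClosed_closedBall (Metric.closedBall_subset_closedBall hs)
  have hbd : BddAbove S := ⟨r₀, fun r hr => by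
    by_contra! hlt
    exact hr₀ (hmono r hr r₀ hlt.le)⟩
  set R := sSup S with hR
  have hR0 : 0 ≤ R := le_csSup hbd hS0
  have hlt : ∀ s < R, IsCompact (Metric.closedBall x s) := fun s hs => by
    obtain ⟨r, hr, hsr⟩ := exists_lt_of_lt_csSup ⟨0, hS0⟩ hs
    exact hmono r hr s hsr.le
  -- The supremum is attained: the ball of radius `R` is within `ε` of a compact smaller ball.
  have hRc : IsCompact (Metric.closedBall x R) := by
    rcases hR0.eq_or_lt with h0 | hpos
    · rw [← h0]; exact hS0.2
    refine TotallyBounded.isCompact_of_isClosed ?_ Metric.isClosed_closedBall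
    rw [Metric.totallyBounded_iff]
    intro ε hε
    set δ := min (ε / 4) R with hδ
    have hδ0 : 0 < δ := lt_min (by linarith) hpos
    obtain ⟨t, htf, ht⟩ := Metric.totallyBounded_iff.1
      (hlt (R - δ) (by linarith)).totallyBounded (ε / 2) (by linarith)
    refine ⟨t, htf, fun y hy => ?_⟩
    obtain ⟨z, hz1, hz2⟩ := hlen x y (R - δ) (ε / 2) (by linarith [min_le_right (ε / 4) R])
      (by linarith) (by
        have := Metric.mem_closedBall'.1 hy
        linarith [min_le_left (ε / 4) R])
    have hz := ht (Metric.mem_closedBall'.2 hz1)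
    simp only [mem_iUnion, Metric.mem_ball, exists_prop] at hz ⊢
    obtain ⟨p, hp, hzp⟩ := hz
    exact ⟨p, hp, by linarith [dist_triangle y z p, dist_comm y z]⟩
  -- Balls slightly larger than `R` lie in a compact thickening of the ball of radius `R`.
  obtain ⟨δ, hδ, hδc⟩ := hRc.exists_isCompact_cthickening
  have hmem : R + δ / 2 ∈ S := by
    refine ⟨by linarith, hδc.of_isClosed_subset Metric.isClosed_closedBall fun y hy => ?_⟩
    obtain ⟨z, hz1, hz2⟩ := hlen x y R δ hR0 hδ.le (by
      have := Metric.mem_closedBall'.1 hy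
      linarith)
    exact Metric.mem_cthickening_of_dist_le y z δ _ (Metric.mem_closedBall'.2 hz1)
      (by rwa [dist_comm])
  linarith [le_csSup hbd hmem]

/-- The Hopf-Rinow theorem: a complete Riemannian manifold is a proper metric space. -/
theorem properSpace_of_completeSpace (n : ℕ) {M : Type*} [MetricSpace M] [CompleteSpace M]
    [ChartedSpace (EuclideanSpace ℝ (Fin n)) M] [IsManifold (𝓡 n) ∞ M]
    [RiemannianBundle (fun x : M => TangentSpace (𝓡 n) x)]
    [IsContMDiffRiemannianBundle (𝓡 n) ∞ (EuclideanSpace ℝ (Fin n))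
      (fun x : M => TangentSpace (𝓡 n) x)] [IsRiemannianManifold (𝓡 n) M] :
    ProperSpace M := by
  have := ChartedSpace.locallyCompactSpace (EuclideanSpace ℝ (Fin n)) M
  exact properSpace_of_exists_dist_le fun x y a b ha hb h =>
    exists_dist_le_dist_le (n := n) ha hb h

/-! ### Calculus in normed spaces -/

section Calculus

variable {E F : Type*} [NormedAddCommGroup E] [NormedSpace ℝ E]
  [NormedAddCommGroup F] [NormedSpace ℝ F]

theorem hasFDerivAt_partial_snd {f : ℝ × E → F} {q : ℝ × E} (hf : DifferentiableAt ℝ f q) :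
    HasFDerivAt (fun v => f (q.1, v)) ((fderiv ℝ f q).comp (ContinuousLinearMap.inr ℝ ℝ E)) q.2 :=
  HasFDerivAt.comp q.2 (g := f) (f := fun v => (q.1, v)) hf.hasFDerivAt
    (hasFDerivAt_prodMk_right q.1 q.2)

theorem contDiffOn_partial_snd {f : ℝ × E → F} {V : Set (ℝ × E)} (hV : IsOpen V)
    (hf : ContDiffOn ℝ ∞ f V) :
    ContDiffOn ℝ ∞ (fun q => fderiv ℝ (fun v => f (q.1, v)) q.2) V := by
  have h1 : ContDiffOn ℝ ∞ (fderiv ℝ f) V :=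
    hf.fderiv_of_isOpen hV (by simp)
  refine (h1.clm_comp (contDiffOn_const (c := ContinuousLinearMap.inr ℝ ℝ E))).congr fun q hq => ?_
  exact (hasFDerivAt_partial_snd ((hf.contDiffAt (hV.mem_nhds hq)).differentiableAt
    (by simp))).fderiv

theorem contDiffOn_partial_fst {f : ℝ × E → F} {V : Set (ℝ × E)} (hV : IsOpen V)
    (hf : ContDiffOn ℝ ∞ f V) :
    (∀ q ∈ V, DifferentiableAt ℝ (fun s => f (s, q.2)) q.1) ∧
      ContinuousOn (fun q => deriv (fun s => f (s, q.2)) q.1) V := by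
  have h : ∀ q ∈ V, HasFDerivAt (fun s => f (s, q.2))
      ((fderiv ℝ f q).comp (ContinuousLinearMap.inl ℝ ℝ E)) q.1 := fun q hq =>
    HasFDerivAt.comp q.1 (g := f) (f := fun s => (s, q.2))
      ((hf.contDiffAt (hV.mem_nhds hq)).differentiableAt (by simp)).hasFDerivAt
      (hasFDerivAt_prodMk_left q.1 q.2)
  refine ⟨fun q hq => (h q hq).differentiableAt, ?_⟩
  have h1 : ContinuousOn (fderiv ℝ f) V := hf.continuousOn_fderiv_of_isOpen hV (by simp)
  refine (h1.clm_apply (continuousOn_const (c := ((1 : ℝ), (0 : E))))).congr fun q hq => ?_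
  simp only
  rw [(h q hq).hasDerivAt.deriv]
  simp

/-- The second order necessary condition at a local minimum. -/
theorem nonneg_of_isLocalMin {g : E → ℝ} {v : E} (hmin : IsLocalMin g v)
    (hg : ∀ᶠ w in 𝓝 v, DifferentiableAt ℝ g w) (hg' : DifferentiableAt ℝ (fderiv ℝ g) v) (a : E) :
    0 ≤ fderiv ℝ (fderiv ℝ g) v a a := by
  -- If `D²g(a, a) < 0`, then `v` is both a local minimum and a local maximum of `g` along the line
  -- through `v` in the direction `a`, so that `g` is constant on this line near `v`.
  by_contra! hneg
  set l : ℝ → E := fun s => v + s • a with hl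
  have hl0 : l 0 = v := by simp [hl]
  have hlD : ∀ s, HasDerivAt l a s := fun s => by
    have := ((hasDerivAt_id s).smul_const a).const_add v
    rwa [one_smul] at this
  have hlc : Tendsto l (𝓝 0) (𝓝 v) := by simpa [hl0] using (hlD 0).continuousAt.tendsto
  have hD : deriv (g ∘ l) =ᶠ[𝓝 0] fun s => fderiv ℝ g (l s) a := by
    filter_upwards [hlc.eventually hg] with s hs
    exact (hs.hasFDerivAt.comp_hasDerivAt s (hlD s)).deriv
  have hDD : HasDerivAt (fun s => fderiv ℝ g (l s) a) (fderiv ℝ (fderiv ℝ g) v a a) 0 := by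
    have h1 : HasFDerivAt (fderiv ℝ g) (fderiv ℝ (fderiv ℝ g) v) (l 0) := by
      rw [hl0]; exact hg'.hasFDerivAt
    have h2 := (h1.comp_hasDerivAt 0 (hlD 0)).clm_apply (hasDerivAt_const (0 : ℝ) a)
    simpa using h2
  have hdd : deriv (deriv (g ∘ l)) 0 = fderiv ℝ (fderiv ℝ g) v a a := by
    rw [hD.deriv_eq, hDD.deriv]
  have hmin' : IsLocalMin (g ∘ l) 0 := by
    have : ∀ᶠ s in 𝓝 (0 : ℝ), g v ≤ g (l s) := hlc.eventually hmin
    simpa [IsLocalMin, IsMinFilter, hl0] using this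
  have hcont : ContinuousAt (g ∘ l) 0 := by
    refine ContinuousAt.comp ?_ (hlD 0).continuousAt
    rw [hl0]
    exact hg.self_of_nhds.continuousAt
  have hmax : IsLocalMax (g ∘ l) 0 :=
    isLocalMax_of_deriv_deriv_neg (by rw [hdd]; exact hneg) hmin'.deriv_eq_zero hcont
  have hconst : g ∘ l =ᶠ[𝓝 0] fun _ => g v := by
    filter_upwards [hmin', hmax] with s h1 h2
    have := le_antisymm h2 h1
    simpa [hl0] using this
  have h0 : deriv (deriv (g ∘ l)) 0 = 0 := by
    rw [hconst.deriv.deriv_eq]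
    simp
  rw [hdd] at h0
  exact hneg.ne h0

/-- A bound for the derivative by the difference quotients from the left, which are all that the
barriers below provide. -/
theorem le_deriv_of_eventually_le {f : ℝ → ℝ} {t C : ℝ} (hf : DifferentiableAt ℝ f t)
    (h : ∀ᶠ s in 𝓝[<] t, f s ≤ f t + C * (s - t)) : C ≤ deriv f t := by
  have h1 := (hasDerivWithinAt_iff_tendsto_slope' (s := Iio t) (by simp)).1
    hf.hasDerivAt.hasDerivWithinAt
  refine ge_of_tendsto h1 ?_
  filter_upwards [h, self_mem_nhdsWithin] with s hs hst
  have hst' : s - t < 0 := sub_neg.2 hst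
  rw [slope_def_field, le_div_iff_of_neg hst']
  linarith

theorem deriv_le_of_eventually_ge {f : ℝ → ℝ} {t C : ℝ} (hf : DifferentiableAt ℝ f t)
    (h : ∀ᶠ s in 𝓝[<] t, f t + C * (s - t) ≤ f s) : deriv f t ≤ C := by
  have h1 := le_deriv_of_eventually_le (C := -C) hf.neg (by
    filter_upwards [h] with s hs
    simp only [Pi.neg_apply]
    linarith)
  rw [deriv.neg] at h1
  linarith

end Calculus

/-! ### Semicontinuous envelopes -/

section Envelopes

variable {X : Type*} [TopologicalSpace X]

/-- The upper semicontinuous envelope on `D` of a function that is locally bounded above on `D`,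
as a real function: the infimum of the bounds valid on `D` near `z`. Where there is no such bound,
the infimum is that of the empty set, and the value has no meaning. -/
def upperEnv (D : Set X) (f : X → ℝ) (z : X) : ℝ := sInf {a | ∀ᶠ q in 𝓝[D] z, f q ≤ a}

variable {D : Set X} {f : X → ℝ} {z : X}

theorem bddBelow_eventually_le (hz : z ∈ D) : BddBelow {a | ∀ᶠ q in 𝓝[D] z, f q ≤ a} :=
  ⟨f z, fun _ ha => (show ∀ᶠ q in 𝓝[D] z, f q ≤ _ from ha).self_of_nhdsWithin hz⟩

theorem upperEnv_le (hz : z ∈ D) {a : ℝ} (ha : ∀ᶠ q in 𝓝[D] z, f q ≤ a) : upperEnv D f z ≤ a :=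
  csInf_le (bddBelow_eventually_le hz) ha

theorem le_upperEnv (hz : z ∈ D) (hb : ∃ a, ∀ᶠ q in 𝓝[D] z, f q ≤ a) : f z ≤ upperEnv D f z :=
  le_csInf hb fun _ ha => (show ∀ᶠ q in 𝓝[D] z, f q ≤ _ from ha).self_of_nhdsWithin hz

theorem eventually_le_of_upperEnv_lt (hb : ∃ a, ∀ᶠ q in 𝓝[D] z, f q ≤ a) {a : ℝ}
    (ha : upperEnv D f z < a) : ∀ᶠ q in 𝓝[D] z, f q ≤ a := by
  obtain ⟨b, hb', hba⟩ := exists_lt_of_csInf_lt hb ha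
  exact Eventually.mono hb' fun q hq => hq.trans hba.le

theorem frequently_lt_of_lt_upperEnv (hz : z ∈ D) {a : ℝ} (ha : a < upperEnv D f z) :
    ∃ᶠ q in 𝓝[D] z, a < f q := by
  intro hev
  exact ha.not_ge (upperEnv_le hz (hev.mono fun q hq => not_lt.1 hq))

theorem upperSemicontinuousOn_upperEnv (hb : ∀ z ∈ D, ∃ a, ∀ᶠ q in 𝓝[D] z, f q ≤ a) :
    UpperSemicontinuousOn (upperEnv D f) D := by
  intro z hz a ha
  obtain ⟨b, hzb, hba⟩ := exists_between ha
  filter_upwards [eventually_eventually_nhdsWithin.2 (eventually_le_of_upperEnv_lt (hb z hz) hzb),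
    self_mem_nhdsWithin] with q hq hqD
  exact (upperEnv_le hqD hq).trans_lt hba

theorem eventually_le_of_upperEnvelope {M : Type*} [MetricSpace M] {D : Set (ℝ × M)}
    {u : ℝ → M → ℝ} {t : ℝ} {x : M} {b a : ℝ} (hb : upperEnvelope D u t x = (b : EReal))
    (ha : b < a) : ∀ᶠ q : ℝ × M in 𝓝[D] (t, x), u q.1 q.2 ≤ a := by
  have h1 : upperEnvelope D u t x < (a : EReal) := by rw [hb]; exact_mod_cast ha
  simp only [upperEnvelope, iInf_lt_iff] at h1
  obtain ⟨r, hr, hlt⟩ := h1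
  have h2 : ∀ᶠ q : ℝ × M in 𝓝 (t, x), |q.1 - t| ≤ r ∧ dist q.2 x ≤ r := by
    filter_upwards [Metric.closedBall_mem_nhds (t, x) hr] with q hq
    exact max_le_iff.1 hq
  filter_upwards [mem_nhdsWithin_of_mem_nhds h2, self_mem_nhdsWithin] with q hq hqD
  have h3 := (le_iSup₂ (f := fun (q : ℝ × M) (_ : q ∈ D ∧ |q.1 - t| ≤ r ∧ dist q.2 x ≤ r) =>
    (u q.1 q.2 : EReal)) q ⟨hqD, hq⟩).trans hlt.le
  exact_mod_cast h3

theorem eventually_le_of_lowerEnvelope {M : Type*} [MetricSpace M] {D : Set (ℝ × M)}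
    {u : ℝ → M → ℝ} {t : ℝ} {x : M} {b a : ℝ} (hb : lowerEnvelope D u t x = (b : EReal))
    (ha : a < b) : ∀ᶠ q : ℝ × M in 𝓝[D] (t, x), a ≤ u q.1 q.2 := by
  have h1 : (a : EReal) < lowerEnvelope D u t x := by rw [hb]; exact_mod_cast ha
  simp only [lowerEnvelope, lt_iSup_iff] at h1
  obtain ⟨r, hr, hlt⟩ := h1
  have h2 : ∀ᶠ q : ℝ × M in 𝓝 (t, x), |q.1 - t| ≤ r ∧ dist q.2 x ≤ r := by
    filter_upwards [Metric.closedBall_mem_nhds (t, x) hr] with q hq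
    exact max_le_iff.1 hq
  filter_upwards [mem_nhdsWithin_of_mem_nhds h2, self_mem_nhdsWithin] with q hq hqD
  have h3 := hlt.le.trans (iInf₂_le (f := fun (q : ℝ × M)
    (_ : q ∈ D ∧ |q.1 - t| ≤ r ∧ dist q.2 x ≤ r) => (u q.1 q.2 : EReal)) q ⟨hqD, hq⟩)
  exact_mod_cast h3

end Envelopes

/-! ### Normed spaces of forms on the model space -/

section Instances

variable {n : ℕ}

/-! Shortcuts for the normed spaces of multilinear forms on the model space. The instances that
`Bundle` makes available for the fibres of Riemannian bundles slow their synthesis down. -/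

instance : NormedAddCommGroup (EuclideanSpace ℝ (Fin n) →L[ℝ] ℝ) :=
  ContinuousLinearMap.toNormedAddCommGroup

instance : NormedSpace ℝ (EuclideanSpace ℝ (Fin n) →L[ℝ] ℝ) :=
  ContinuousLinearMap.toNormedSpace

instance : NormedAddCommGroup (EuclideanSpace ℝ (Fin n) →L[ℝ] EuclideanSpace ℝ (Fin n)) :=
  ContinuousLinearMap.toNormedAddCommGroup

instance : NormedSpace ℝ (EuclideanSpace ℝ (Fin n) →L[ℝ] EuclideanSpace ℝ (Fin n)) :=
  ContinuousLinearMap.toNormedSpace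

instance : NormedAddCommGroup
    (EuclideanSpace ℝ (Fin n) →L[ℝ] EuclideanSpace ℝ (Fin n) →L[ℝ] ℝ) :=
  ContinuousLinearMap.toNormedAddCommGroup

instance : NormedSpace ℝ
    (EuclideanSpace ℝ (Fin n) →L[ℝ] EuclideanSpace ℝ (Fin n) →L[ℝ] ℝ) :=
  ContinuousLinearMap.toNormedSpace

end Instances

section Charts

variable {n : ℕ}

/-- The model space of the charts. -/
local notation "𝔼" => EuclideanSpace ℝ (Fin n)

variable {M : Type*} [MetricSpace M] [ChartedSpace (EuclideanSpace ℝ (Fin n)) M]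
  [IsManifold (𝓡 n) ∞ M] [RiemannianBundle (fun x : M => TangentSpace (𝓡 n) x)]

/-! ### The metric in a chart -/

section Metric

/-- The differential at `y` of the chart at `c`, as a map into the model space. -/
def chartDeriv (c y : M) : TangentSpace (𝓡 n) y →L[ℝ] 𝔼 :=
  mfderiv (𝓡 n) 𝓘(ℝ, 𝔼) (extChartAt (𝓡 n) c) y

/-- The differential at `v` of the inverse of the chart at `c`. -/
def chartDerivSymm (c : M) (v : 𝔼) : 𝔼 →L[ℝ] TangentSpace (𝓡 n) ((extChartAt (𝓡 n) c).symm v) :=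
  mfderiv 𝓘(ℝ, 𝔼) (𝓡 n) (extChartAt (𝓡 n) c).symm v

theorem chartDeriv_chartDerivSymm {c : M} {v : 𝔼} (hv : v ∈ (extChartAt (𝓡 n) c).target) (a : 𝔼) :
    chartDeriv c ((extChartAt (𝓡 n) c).symm v) (chartDerivSymm c v a) = a := by
  have h := mfderiv_extChartAt_comp_mfderivWithin_extChartAt_symm (I := 𝓡 n) hv
  rw [ModelWithCorners.range_eq_univ, mfderivWithin_univ] at h
  exact DFunLike.congr_fun h a

theorem chartDerivSymm_chartDeriv {c : M} {v : 𝔼} (hv : v ∈ (extChartAt (𝓡 n) c).target)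
    (X : TangentSpace (𝓡 n) ((extChartAt (𝓡 n) c).symm v)) :
    chartDerivSymm c v (chartDeriv c ((extChartAt (𝓡 n) c).symm v) X) = X := by
  have h := mfderivWithin_extChartAt_symm_comp_mfderiv_extChartAt (I := 𝓡 n) hv
  rw [ModelWithCorners.range_eq_univ, mfderivWithin_univ] at h
  exact DFunLike.congr_fun h X

/-- The trivialization of the tangent bundle at `c` is given by the differential of the chart, so
the chart metric consists of the coefficients of the smooth bundle metric in this trivialization. -/
theorem symmL_eq_chartDerivSymm {c : M} {v : 𝔼} (hv : v ∈ (extChartAt (𝓡 n) c).target) :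
    (trivializationAt 𝔼 (TangentSpace (𝓡 n)) c).symmL ℝ ((extChartAt (𝓡 n) c).symm v) =
      chartDerivSymm c v := by
  have hy : (extChartAt (𝓡 n) c).symm v ∈ (chartAt 𝔼 c).source := by
    simpa using (extChartAt (𝓡 n) c).map_target hv
  have h := TangentBundle.symmL_trivializationAt (I := 𝓡 n) hy
  rw [ModelWithCorners.range_eq_univ, mfderivWithin_univ, (extChartAt (𝓡 n) c).right_inv hv] at h
  exact h

theorem chartMetric_eq (c : M) (v a b : 𝔼) :
    chartMetric c v a b = inner ℝ (chartDerivSymm c v a) (chartDerivSymm c v b) := rfl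

theorem chartMetric_comm (c : M) (v a b : 𝔼) : chartMetric c v a b = chartMetric c v b a :=
  real_inner_comm _ _

/-- The metric in the chart at `c`, as a bilinear form. -/
def chartMetricL (c : M) (v : 𝔼) : 𝔼 →L[ℝ] 𝔼 →L[ℝ] ℝ :=
  LinearMap.toContinuousLinearMap
    (LinearMap.toContinuousLinearMap.toLinearMap ∘ₗ
      LinearMap.mk₂ ℝ (chartMetric c v)
        (fun a a' b => (congrArg (inner ℝ · (chartDerivSymm c v b))
          ((chartDerivSymm c v).map_add a a')).trans (inner_add_left _ _ _))
        (fun r a b => (congrArg (inner ℝ · (chartDerivSymm c v b))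
          ((chartDerivSymm c v).map_smul r a)).trans (real_inner_smul_left _ _ _))
        (fun a b b' => (congrArg (inner ℝ (chartDerivSymm c v a))
          ((chartDerivSymm c v).map_add b b')).trans (inner_add_right _ _ _))
        (fun r a b => (congrArg (inner ℝ (chartDerivSymm c v a))
          ((chartDerivSymm c v).map_smul r b)).trans (real_inner_smul_right _ _ _)))

theorem chartMetricL_apply (c : M) (v a b : 𝔼) : chartMetricL c v a b = chartMetric c v a b := rfl

theorem eq_zero_of_chartMetric_self {c : M} {v a : 𝔼} (hv : v ∈ (extChartAt (𝓡 n) c).target)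
    (h : chartMetric c v a a = 0) : a = 0 := by
  rw [chartMetric_eq, inner_self_eq_zero] at h
  rw [← chartDeriv_chartDerivSymm hv a, h, map_zero]

theorem contDiffOn_chartMetric [IsContMDiffRiemannianBundle (𝓡 n) ∞ 𝔼
      (fun x : M => TangentSpace (𝓡 n) x)] (c : M) (a b : 𝔼) :
    ContDiffOn ℝ ∞ (fun v => chartMetric c v a b) (extChartAt (𝓡 n) c).target := by
  have key : ∀ a : 𝔼, ContMDiffOn 𝓘(ℝ, 𝔼) ((𝓡 n).prod 𝓘(ℝ, 𝔼)) ∞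
      (fun v => (⟨(extChartAt (𝓡 n) c).symm v, chartDerivSymm c v a⟩ :
        TotalSpace 𝔼 (TangentSpace (𝓡 n) : M → Type _))) (extChartAt (𝓡 n) c).target := by
    intro a
    have h1 : ContMDiffOn 𝓘(ℝ, 𝔼) ((𝓡 n).prod 𝓘(ℝ, 𝔼)) ∞
        (fun v => ((extChartAt (𝓡 n) c).symm v, a)) (extChartAt (𝓡 n) c).target :=
      (contMDiffOn_extChartAt_symm c).prodMk contMDiffOn_const
    have h2 := (trivializationAt 𝔼 (TangentSpace (𝓡 n)) c).contMDiffOn_symm (n := ∞) (IB := 𝓡 n)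
    have hmem : ∀ v ∈ (extChartAt (𝓡 n) c).target, (extChartAt (𝓡 n) c).symm v ∈
        (trivializationAt 𝔼 (TangentSpace (𝓡 n)) c).baseSet := fun v hv => by
      simpa using (extChartAt (𝓡 n) c).map_target hv
    refine (h2.comp h1 fun v hv => ?_).congr fun v hv => ?_
    · rw [mem_preimage, Trivialization.mem_target]
      exact hmem v hv
    · rw [← symmL_eq_chartDerivSymm hv, Function.comp_apply,
        Trivialization.symmL_apply _ (hmem v hv)]
      exact Trivialization.mk_symm _ (hmem v hv) a
  exact contMDiffOn_iff_contDiffOn.1 (ContMDiffOn.inner_bundle (key a) (key b))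

end Metric

/-! ### Christoffel symbols -/

section Christoffel

theorem EuclideanSpace.clm_ext_single {F : Type*} [NormedAddCommGroup F] [NormedSpace ℝ F]
    {f g : 𝔼 →L[ℝ] F}
    (h : ∀ i, f (EuclideanSpace.single i 1) = g (EuclideanSpace.single i 1)) : f = g := by
  refine ContinuousLinearMap.coe_injective
    ((EuclideanSpace.basisFun (Fin n) ℝ).toBasis.ext fun i => ?_)
  simpa using h i

theorem EuclideanSpace.sum_smul_single (x : 𝔼) :
    ∑ i, x i • (EuclideanSpace.single i (1 : ℝ) : 𝔼) = x := by
  simpa using (EuclideanSpace.basisFun (Fin n) ℝ).sum_repr x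

theorem chartMetricMatrix_mulVec (c : M) (v x : 𝔼) (l : Fin n) :
    (chartMetricMatrix c v).mulVec x l = chartMetricL c v x (EuclideanSpace.single l 1) := by
  conv_rhs => rw [← EuclideanSpace.sum_smul_single x]
  simp only [map_sum, map_smul, sum_apply, smul_apply,
    Matrix.mulVec, dotProduct, chartMetricL_apply, smul_eq_mul]
  refine Finset.sum_congr rfl fun i _ => ?_
  rw [mul_comm, chartMetric_comm]
  rfl

theorem isUnit_det_chartMetricMatrix {c : M} {v : 𝔼} (hv : v ∈ (extChartAt (𝓡 n) c).target) :
    IsUnit (chartMetricMatrix c v).det := by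
  rw [isUnit_iff_ne_zero]
  intro h0
  obtain ⟨x, hx, hx0⟩ := Matrix.exists_mulVec_eq_zero_iff.2 h0
  have h1 : chartMetricL c v (WithLp.toLp 2 x) = 0 := EuclideanSpace.clm_ext_single fun l => by
    rw [← chartMetricMatrix_mulVec]
    simpa using congrFun hx0 l
  have h2 := eq_zero_of_chartMetric_self hv
    (by rw [← chartMetricL_apply, h1]; rfl :
      chartMetric c v (WithLp.toLp 2 x) (WithLp.toLp 2 x) = 0)
  exact hx (by simpa using h2)

variable [IsContMDiffRiemannianBundle (𝓡 n) ∞ (EuclideanSpace ℝ (Fin n))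
      (fun x : M => TangentSpace (𝓡 n) x)]

theorem contDiffOn_chartMetricL (c : M) :
    ContDiffOn ℝ ∞ (chartMetricL c) (extChartAt (𝓡 n) c).target :=
  contDiffOn_clm_apply.2 fun a => contDiffOn_clm_apply.2 fun b => contDiffOn_chartMetric c a b

theorem hasFDerivAt_chartMetricL {c : M} {v : 𝔼} (hv : v ∈ (extChartAt (𝓡 n) c).target) :
    HasFDerivAt (chartMetricL c) (fderiv ℝ (chartMetricL c) v) v :=
  (((contDiffOn_chartMetricL c).contDiffAt ((isOpen_extChartAt_target c).mem_nhds
    hv)).differentiableAt (by simp)).hasFDerivAt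

theorem fderiv_chartMetric {c : M} {v : 𝔼} (hv : v ∈ (extChartAt (𝓡 n) c).target) (a b d : 𝔼) :
    fderiv ℝ (fun w => chartMetric c w a b) v d = fderiv ℝ (chartMetricL c) v d a b := by
  have h := ((hasFDerivAt_chartMetricL hv).clm_apply (hasFDerivAt_const a v)).clm_apply
    (hasFDerivAt_const b v)
  have h' : HasFDerivAt (fun w => chartMetric c w a b) _ v := h
  rw [h'.fderiv]
  simp

theorem christoffelFirst_eq {c : M} {v : 𝔼} (hv : v ∈ (extChartAt (𝓡 n) c).target) (a b d : 𝔼) :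
    christoffelFirst c v a b d = (1 / 2 : ℝ) * (fderiv ℝ (chartMetricL c) v a b d
      + fderiv ℝ (chartMetricL c) v b a d - fderiv ℝ (chartMetricL c) v d a b) := by
  simp only [christoffelFirst, fderiv_chartMetric hv]

/-- The Christoffel symbols of the second kind are those of the first kind with an index raised:
`g(Γ(a, b), d) = Γ_d(a, b)`. -/
theorem chartMetricL_christoffel {c : M} {v : 𝔼} (hv : v ∈ (extChartAt (𝓡 n) c).target)
    (a b d : 𝔼) : chartMetricL c v (christoffel c v a b) d = christoffelFirst c v a b d := by
  have h1 : ∀ l, chartMetricL c v (christoffel c v a b) (EuclideanSpace.single l 1) =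
      christoffelFirst c v a b (EuclideanSpace.single l 1) := fun l => by
    rw [← chartMetricMatrix_mulVec, christoffel, WithLp.ofLp_toLp, Matrix.mulVec_mulVec,
      Matrix.mul_nonsing_inv _ (isUnit_det_chartMetricMatrix hv), Matrix.one_mulVec]
  rw [← EuclideanSpace.sum_smul_single d]
  simp only [map_sum, map_smul, h1, christoffelFirst_eq hv, sum_apply,
    smul_apply, smul_eq_mul, Finset.mul_sum, ← Finset.sum_add_distrib,
    ← Finset.sum_sub_distrib]
  exact Finset.sum_congr rfl fun i _ => by ring

theorem eq_of_chartMetricL_eq {c : M} {v : 𝔼} (hv : v ∈ (extChartAt (𝓡 n) c).target) {x y : 𝔼}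
    (h : ∀ d, chartMetricL c v x d = chartMetricL c v y d) : x = y := by
  refine sub_eq_zero.1 (eq_zero_of_chartMetric_self hv ?_)
  rw [← chartMetricL_apply, map_sub (chartMetricL c v) x y, sub_apply, h, sub_self]

theorem christoffel_comm {c : M} {v : 𝔼} (hv : v ∈ (extChartAt (𝓡 n) c).target) (a b : 𝔼) :
    christoffel c v a b = christoffel c v b a := by
  have hsymm : ∀ d : 𝔼, fderiv ℝ (chartMetricL c) v d a b = fderiv ℝ (chartMetricL c) v d b a := by
    intro d
    rw [← fderiv_chartMetric hv, ← fderiv_chartMetric hv]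
    simp only [chartMetric_comm c _ a b]
  refine eq_of_chartMetricL_eq hv fun d => ?_
  rw [chartMetricL_christoffel hv, chartMetricL_christoffel hv, christoffelFirst_eq hv,
    christoffelFirst_eq hv, hsymm]
  ring

/-- The Christoffel symbols at a point of the chart at `c`, as a bilinear map. Outside the target of
the chart, where the matrix of the metric may be singular, the value is `0`. -/
def christoffelL (c : M) (v : 𝔼) : 𝔼 →L[ℝ] 𝔼 →L[ℝ] 𝔼 :=
  open scoped Classical in
  if hv : v ∈ (extChartAt (𝓡 n) c).target then
    LinearMap.toContinuousLinearMap
      (LinearMap.toContinuousLinearMap.toLinearMap ∘ₗ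
        LinearMap.mk₂ ℝ (christoffel c v)
          (fun a a' b => eq_of_chartMetricL_eq hv fun d => by
            simp only [map_add, add_apply, chartMetricL_christoffel hv,
              christoffelFirst_eq hv]
            ring)
          (fun r a b => eq_of_chartMetricL_eq hv fun d => by
            simp only [map_smul, smul_apply, chartMetricL_christoffel hv,
              christoffelFirst_eq hv, smul_eq_mul]
            ring)
          (fun a b b' => eq_of_chartMetricL_eq hv fun d => by
            simp only [map_add, add_apply, chartMetricL_christoffel hv,
              christoffelFirst_eq hv]
            ring)
          (fun r a b => eq_of_chartMetricL_eq hv fun d => by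
            simp only [map_smul, smul_apply, chartMetricL_christoffel hv,
              christoffelFirst_eq hv, smul_eq_mul]
            ring))
  else 0

theorem christoffelL_apply {c : M} {v : 𝔼} (hv : v ∈ (extChartAt (𝓡 n) c).target) (a b : 𝔼) :
    christoffelL c v a b = christoffel c v a b := by
  rw [christoffelL, dif_pos hv]
  rfl

theorem continuousOn_christoffelL (c : M) :
    ContinuousOn (christoffelL c) (extChartAt (𝓡 n) c).target := by
  refine continuousOn_clm_apply.2 fun a => continuousOn_clm_apply.2 fun b => ?_
  refine ContinuousOn.congr ?_ fun v hv => christoffelL_apply hv a b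
  have hD : ContinuousOn (fderiv ℝ (chartMetricL c)) (extChartAt (𝓡 n) c).target :=
    (contDiffOn_chartMetricL c).continuousOn_fderiv_of_isOpen (isOpen_extChartAt_target c) (by simp)
  have hD' : ∀ a b d, ContinuousOn (fun v => fderiv ℝ (chartMetricL c) v a b d)
      (extChartAt (𝓡 n) c).target := fun a b d =>
    ((hD.clm_apply continuousOn_const).clm_apply continuousOn_const).clm_apply continuousOn_const
  have hfirst : ContinuousOn (fun v => fun l : Fin n =>
      christoffelFirst c v a b (EuclideanSpace.single l 1)) (extChartAt (𝓡 n) c).target := by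
    refine continuousOn_pi.2 fun l => ContinuousOn.congr ?_ fun v hv => christoffelFirst_eq hv a b _
    exact continuousOn_const.mul (((hD' _ _ _).add (hD' _ _ _)).sub (hD' _ _ _))
  have hmat : ContinuousOn (chartMetricMatrix c) (extChartAt (𝓡 n) c).target :=
    continuousOn_pi.2 fun i => continuousOn_pi.2 fun j =>
      (contDiffOn_chartMetric c _ _).continuousOn
  have hinv : ContinuousOn (fun v => (chartMetricMatrix c v)⁻¹) (extChartAt (𝓡 n) c).target := by
    intro v hv
    have h1 : ContinuousAt Ring.inverse (chartMetricMatrix c v).det := by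
      have := NormedRing.inverse_continuousAt (isUnit_det_chartMetricMatrix hv).unit
      simpa using this
    exact (continuousAt_matrix_inv _ h1).comp_continuousWithinAt (hmat v hv)
  refine (PiLp.continuous_toLp 2 _).comp_continuousOn ?_
  exact (continuous_fst.matrix_mulVec continuous_snd).comp_continuousOn (hinv.prodMk hfirst)

end Christoffel

/-! ### Coordinate changes and the Riemannian Hessian -/

section Transition

/-- The coordinate change from the chart at `c` to the chart at `c'`. -/
def transition (c c' : M) (v : 𝔼) : 𝔼 := extChartAt (𝓡 n) c' ((extChartAt (𝓡 n) c).symm v)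

/-- The domain of the coordinate change from the chart at `c` to the chart at `c'`. -/
def transitionDomain (c c' : M) : Set 𝔼 :=
  (extChartAt (𝓡 n) c).target ∩ (extChartAt (𝓡 n) c).symm ⁻¹' (extChartAt (𝓡 n) c').source

theorem isOpen_transitionDomain (c c' : M) : IsOpen (transitionDomain (n := n) c c') :=
  (continuousOn_extChartAt_symm c).isOpen_inter_preimage (isOpen_extChartAt_target c)
    (isOpen_extChartAt_source c')

theorem contDiffOn_transition (c c' : M) :
    ContDiffOn ℝ ∞ (transition (n := n) c c') (transitionDomain c c') := by
  have h := contDiffOn_ext_coord_change (I := 𝓡 n) (n := ∞) c' c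
  refine h.mono fun v hv => ?_
  rw [PartialEquiv.trans_source, PartialEquiv.symm_source]
  exact hv

theorem contDiffAt_transition {c c' : M} {v : 𝔼} (hv : v ∈ transitionDomain c c') :
    ContDiffAt ℝ ∞ (transition (n := n) c c') v :=
  (contDiffOn_transition c c').contDiffAt ((isOpen_transitionDomain c c').mem_nhds hv)

theorem differentiableAt_transition {c c' : M} {v : 𝔼} (hv : v ∈ transitionDomain c c') :
    DifferentiableAt ℝ (transition (n := n) c c') v :=
  (contDiffAt_transition hv).differentiableAt (by simp)

theorem hasFDerivAt_fderiv_transition {c c' : M} {v : 𝔼} (hv : v ∈ transitionDomain c c') :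
    HasFDerivAt (fderiv ℝ (transition (n := n) c c'))
      (fderiv ℝ (fderiv ℝ (transition (n := n) c c')) v) v :=
  (((contDiffAt_transition hv).fderiv_right (m := 1)
    (by rw [one_add_one_eq_two]; exact ENat.LEInfty.out)).differentiableAt
    (by simp)).hasFDerivAt

theorem transition_mem_target {c c' : M} {v : 𝔼} (hv : v ∈ transitionDomain c c') :
    transition c c' v ∈ (extChartAt (𝓡 n) c').target :=
  (extChartAt (𝓡 n) c').map_source hv.2

theorem symm_transition {c c' : M} {v : 𝔼} (hv : v ∈ transitionDomain c c') :
    (extChartAt (𝓡 n) c').symm (transition c c' v) = (extChartAt (𝓡 n) c).symm v :=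
  (extChartAt (𝓡 n) c').left_inv hv.2

theorem chartDeriv_comp_chartDerivSymm {c c' : M} {v : 𝔼} (hv : v ∈ transitionDomain c c') (a : 𝔼) :
    chartDeriv c' ((extChartAt (𝓡 n) c).symm v) (chartDerivSymm c v a) =
      fderiv ℝ (transition c c') v a := by
  have h1 : MDifferentiableAt 𝓘(ℝ, 𝔼) (𝓡 n) (extChartAt (𝓡 n) c).symm v := by
    have := mdifferentiableWithinAt_extChartAt_symm (I := 𝓡 n) hv.1
    rwa [ModelWithCorners.range_eq_univ, mdifferentiableWithinAt_univ] at this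
  have h2 : MDifferentiableAt (𝓡 n) 𝓘(ℝ, 𝔼) (extChartAt (𝓡 n) c')
      ((extChartAt (𝓡 n) c).symm v) := mdifferentiableAt_extChartAt (by simpa using hv.2)
  have h3 := mfderiv_comp v h2 h1
  rw [mfderiv_eq_fderiv] at h3
  exact (DFunLike.congr_fun h3 a).symm

theorem chartDeriv_eq_fderiv_transition {c c' : M} {v : 𝔼} (hv : v ∈ transitionDomain c c')
    (X : TangentSpace (𝓡 n) ((extChartAt (𝓡 n) c).symm v)) :
    chartDeriv c' ((extChartAt (𝓡 n) c).symm v) X =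
      fderiv ℝ (transition c c') v (chartDeriv c ((extChartAt (𝓡 n) c).symm v) X) := by
  rw [← chartDeriv_comp_chartDerivSymm hv, chartDerivSymm_chartDeriv hv.1]

theorem chartMetric_chartDeriv {c y : M} (hy : y ∈ (extChartAt (𝓡 n) c).source)
    (X Y : TangentSpace (𝓡 n) y) :
    chartMetric c (extChartAt (𝓡 n) c y) (chartDeriv c y X) (chartDeriv c y Y) = inner ℝ X Y := by
  obtain ⟨w, hw, rfl⟩ : ∃ w ∈ (extChartAt (𝓡 n) c).target, (extChartAt (𝓡 n) c).symm w = y :=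
    ⟨_, (extChartAt (𝓡 n) c).map_source hy, (extChartAt (𝓡 n) c).left_inv hy⟩
  rw [(extChartAt (𝓡 n) c).right_inv hw, chartMetric_eq, chartDerivSymm_chartDeriv hw,
    chartDerivSymm_chartDeriv hw]

theorem chartMetric_transition {c c' : M} {v : 𝔼} (hv : v ∈ transitionDomain c c') (a b : 𝔼) :
    chartMetric c' (transition c c' v) (fderiv ℝ (transition c c') v a)
      (fderiv ℝ (transition c c') v b) = chartMetric c v a b := by
  rw [← chartDeriv_comp_chartDerivSymm hv, ← chartDeriv_comp_chartDerivSymm hv]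
  exact chartMetric_chartDeriv hv.2 _ _

/-- The coordinate change is an isometry of the chart metrics, so its differential is injective. -/
theorem fderiv_transition_surjective {c c' : M} {v : 𝔼} (hv : v ∈ transitionDomain c c') :
    Function.Surjective (fderiv ℝ (transition (n := n) c c') v) := by
  refine (LinearMap.injective_iff_surjective
    (f := (fderiv ℝ (transition (n := n) c c') v : 𝔼 →ₗ[ℝ] 𝔼))).1 ?_
  refine (injective_iff_map_eq_zero _).2 fun a ha => eq_zero_of_chartMetric_self hv.1 ?_
  have ha' : fderiv ℝ (transition (n := n) c c') v a = 0 := ha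
  rw [← chartMetric_transition hv, ha', ← chartMetricL_apply, map_zero]

variable [IsContMDiffRiemannianBundle (𝓡 n) ∞ (EuclideanSpace ℝ (Fin n))
      (fun x : M => TangentSpace (𝓡 n) x)]

/-- The derivative of the identity `g(a, b) = g'(τ'a, τ'b)` relating the metric in two charts. -/
theorem fderiv_chartMetricL_transition {c c' : M} {v : 𝔼} (hv : v ∈ transitionDomain c c')
    (a b d : 𝔼) :
    fderiv ℝ (chartMetricL c) v a b d =
      fderiv ℝ (chartMetricL c') (transition c c' v) (fderiv ℝ (transition c c') v a)
        (fderiv ℝ (transition c c') v b) (fderiv ℝ (transition c c') v d)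
      + chartMetricL c' (transition c c' v) (fderiv ℝ (fderiv ℝ (transition c c')) v a b)
        (fderiv ℝ (transition c c') v d)
      + chartMetricL c' (transition c c' v) (fderiv ℝ (transition c c') v b)
        (fderiv ℝ (fderiv ℝ (transition c c')) v a d) := by
  have hτ := (differentiableAt_transition hv).hasFDerivAt
  have hτ' := hasFDerivAt_fderiv_transition hv
  have h1 := (((hasFDerivAt_chartMetricL (transition_mem_target hv)).comp v hτ).clm_apply
    (hτ'.clm_apply (hasFDerivAt_const b v))).clm_apply (hτ'.clm_apply (hasFDerivAt_const d v))
  have h2 : (fun w => chartMetric c w b d) =ᶠ[𝓝 v] fun w =>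
      chartMetricL c' (transition c c' w) (fderiv ℝ (transition c c') w b)
        (fderiv ℝ (transition c c') w d) := by
    filter_upwards [(isOpen_transitionDomain c c').mem_nhds hv] with w hw
    exact (chartMetric_transition hw b d).symm
  rw [← fderiv_chartMetric hv.1, h2.fderiv_eq]
  have h1' : HasFDerivAt (fun w => chartMetricL c' (transition c c' w)
    (fderiv ℝ (transition c c') w b) (fderiv ℝ (transition c c') w d)) _ v := h1
  rw [h1'.fderiv]
  simp
  ring

/-- The transformation law of the Christoffel symbols. -/
theorem christoffel_transition {c c' : M} {v : 𝔼} (hv : v ∈ transitionDomain c c') (a b : 𝔼) :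
    fderiv ℝ (transition c c') v (christoffel c v a b) =
      christoffel c' (transition c c' v) (fderiv ℝ (transition c c') v a)
        (fderiv ℝ (transition c c') v b) + fderiv ℝ (fderiv ℝ (transition c c')) v a b := by
  have hv' := transition_mem_target hv
  have hsymm : ∀ x y : 𝔼, fderiv ℝ (fderiv ℝ (transition c c')) v x y =
      fderiv ℝ (fderiv ℝ (transition c c')) v y x := fun x y =>
    ((contDiffAt_transition hv).isSymmSndFDerivAt (by simpa using ENat.LEInfty.out)).eq x y
  refine eq_of_chartMetricL_eq hv' fun d' => ?_
  obtain ⟨d, rfl⟩ := fderiv_transition_surjective hv d'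
  rw [chartMetricL_apply, chartMetric_transition hv, ← chartMetricL_apply,
    chartMetricL_christoffel hv.1, map_add, add_apply, chartMetricL_christoffel hv',
    christoffelFirst_eq hv.1, christoffelFirst_eq hv', fderiv_chartMetricL_transition hv,
    fderiv_chartMetricL_transition hv, fderiv_chartMetricL_transition hv]
  have hG : ∀ x y : 𝔼, chartMetricL c' (transition c c' v) x y =
      chartMetricL c' (transition c c' v) y x := fun x y => chartMetric_comm _ _ _ _
  rw [hsymm b a, hsymm d a, hsymm d b, hG (fderiv ℝ (fderiv ℝ (transition c c')) v a d),
    hG (fderiv ℝ (transition c c') v a) (fderiv ℝ (fderiv ℝ (transition c c')) v b d)]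
  ring

/-- The Hessian does not depend on the chart in which it is computed. -/
theorem hessianInChart_eq_hessianInChart {c c' x : M} (hx : x ∈ (extChartAt (𝓡 n) c).source)
    (hx' : x ∈ (extChartAt (𝓡 n) c').source) {f : M → ℝ}
    (hf : ∀ᶠ w in 𝓝 (extChartAt (𝓡 n) c' x),
      DifferentiableAt ℝ (fun w => f ((extChartAt (𝓡 n) c').symm w)) w)
    (hf' : DifferentiableAt ℝ (fderiv ℝ (fun w => f ((extChartAt (𝓡 n) c').symm w)))
      (extChartAt (𝓡 n) c' x)) (X Y : TangentSpace (𝓡 n) x) :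
    hessianInChart c f x X Y = hessianInChart c' f x X Y := by
  obtain ⟨v, hv, rfl⟩ : ∃ v ∈ (extChartAt (𝓡 n) c).target, (extChartAt (𝓡 n) c).symm v = x :=
    ⟨_, (extChartAt (𝓡 n) c).map_source hx, (extChartAt (𝓡 n) c).left_inv hx⟩
  have hvO : v ∈ transitionDomain c c' := ⟨hv, hx'⟩
  set g' : 𝔼 → ℝ := fun w => f ((extChartAt (𝓡 n) c').symm w) with hg'
  set g : 𝔼 → ℝ := fun w => f ((extChartAt (𝓡 n) c).symm w) with hg
  set τ : 𝔼 → 𝔼 := transition c c' with hτdef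
  have hO := (isOpen_transitionDomain c c').mem_nhds hvO
  have hf1 : ∀ᶠ u in 𝓝 v, DifferentiableAt ℝ g' (τ u) :=
    (differentiableAt_transition hvO).continuousAt.eventually hf
  have hD : fderiv ℝ g =ᶠ[𝓝 v] fun u => (fderiv ℝ g' (τ u)).comp (fderiv ℝ τ u) := by
    filter_upwards [hf1, hO] with u hu huO
    have h1 : g =ᶠ[𝓝 u] g' ∘ τ := by
      filter_upwards [(isOpen_transitionDomain c c').mem_nhds huO] with w hw
      simp only [hg, hg', Function.comp_apply, hτdef, symm_transition hw]
    rw [h1.fderiv_eq, fderiv_comp u hu (differentiableAt_transition huO)]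
  have hDD : HasFDerivAt (fun u => (fderiv ℝ g' (τ u)).comp (fderiv ℝ τ u)) _ v :=
    HasFDerivAt.clm_comp (c := fun u => fderiv ℝ g' (τ u))
      (HasFDerivAt.comp v (g := fderiv ℝ g') (f := τ) (g' := fderiv ℝ (fderiv ℝ g') (τ v))
      hf'.hasFDerivAt (differentiableAt_transition hvO).hasFDerivAt)
      (hasFDerivAt_fderiv_transition hvO)
  have e1 : (extChartAt (𝓡 n) c) ((extChartAt (𝓡 n) c).symm v) = v :=
    (extChartAt (𝓡 n) c).right_inv hv
  have e2 : ∀ Z : TangentSpace (𝓡 n) ((extChartAt (𝓡 n) c).symm v),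
      chartDeriv c' ((extChartAt (𝓡 n) c).symm v) Z =
      fderiv ℝ τ v (chartDeriv c ((extChartAt (𝓡 n) c).symm v) Z) :=
    chartDeriv_eq_fderiv_transition hvO
  have e3 : (extChartAt (𝓡 n) c') ((extChartAt (𝓡 n) c).symm v) = τ v := rfl
  change fderiv ℝ (fderiv ℝ g) _ (chartDeriv c _ X) (chartDeriv c _ Y) -
      fderiv ℝ g _ (christoffel c _ (chartDeriv c _ X) (chartDeriv c _ Y)) =
    fderiv ℝ (fderiv ℝ g') _ (chartDeriv c' _ X) (chartDeriv c' _ Y) -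
      fderiv ℝ g' _ (christoffel c' _ (chartDeriv c' _ X) (chartDeriv c' _ Y))
  rw [e1, e2, e2, e3, hD.fderiv_eq, hD.eq_of_nhds, hDD.fderiv, ContinuousLinearMap.comp_apply,
    christoffel_transition hvO, map_add]
  simp only [add_apply, ContinuousLinearMap.comp_apply, ContinuousLinearMap.compL_apply,
    ContinuousLinearMap.flip_apply]
  simp only [hτdef]
  ring

end Transition

/-! ### Coordinates on the bundle of jets -/

section Bundle

/-- The covector at `y` with coordinates `ξ` in the chart at `c`. -/
def covectorOfChart (c y : M) (ξ : 𝔼 →L[ℝ] ℝ) : Covector n y := ξ.comp (chartDeriv c y)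

/-- The bilinear form at `y` with coordinates `B` in the chart at `c`. -/
def bilinFormOfChart (c y : M) (B : 𝔼 →L[ℝ] 𝔼 →L[ℝ] ℝ) : BilinForm n y :=
  (ContinuousLinearMap.precomp ℝ (chartDeriv c y)).comp (B.comp (chartDeriv c y))

theorem bilinFormOfChart_apply (c y : M) (B : 𝔼 →L[ℝ] 𝔼 →L[ℝ] ℝ) (X Y : TangentSpace (𝓡 n) y) :
    bilinFormOfChart c y B X Y = B (chartDeriv c y X) (chartDeriv c y Y) := rfl

theorem chartDeriv_symmL {c y : M} (hy : y ∈ (chartAt 𝔼 c).source) (a : 𝔼) :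
    chartDeriv c y ((trivializationAt 𝔼 (TangentSpace (𝓡 n)) c).symmL ℝ y a) = a := by
  have h := Trivialization.continuousLinearMapAt_symmL (R := ℝ)
    (trivializationAt 𝔼 (TangentSpace (𝓡 n)) c) (b := y) (by simpa using hy) a
  rwa [TangentBundle.continuousLinearMapAt_trivializationAt hy] at h

theorem trivializationAt_covectorOfChart {c y : M} (hy : y ∈ (chartAt 𝔼 c).source)
    (ξ : 𝔼 →L[ℝ] ℝ) :
    trivializationAt (𝔼 →L[ℝ] ℝ) (fun x : M => Covector n x) c ⟨y, covectorOfChart c y ξ⟩ =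
      (y, ξ) := by
  refine (hom_trivializationAt_apply (RingHom.id ℝ) c _).trans ?_
  refine Prod.ext rfl ?_
  ext a
  simp only [ContinuousLinearMap.inCoordinates, ContinuousLinearMap.comp_apply]
  refine (DFunLike.congr_fun
    (Bundle.Trivial.continuousLinearMapAt_trivialization ℝ M ℝ y) _).trans ?_
  exact congrArg ξ (chartDeriv_symmL hy a)

theorem trivializationAt_bilinFormOfChart {c y : M} (hy : y ∈ (chartAt 𝔼 c).source)
    (B : 𝔼 →L[ℝ] 𝔼 →L[ℝ] ℝ) :
    trivializationAt (𝔼 →L[ℝ] 𝔼 →L[ℝ] ℝ) (fun x : M => BilinForm n x) c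
      ⟨y, bilinFormOfChart c y B⟩ = (y, B) := by
  refine (hom_trivializationAt_apply (RingHom.id ℝ) c _).trans ?_
  refine Prod.ext rfl ?_
  refine ContinuousLinearMap.ext fun a => ?_
  have h1 : bilinFormOfChart c y B ((trivializationAt 𝔼 (TangentSpace (𝓡 n)) c).symmL ℝ y a) =
      covectorOfChart c y (B a) := by
    refine ContinuousLinearMap.ext fun Y => ?_
    rw [bilinFormOfChart_apply, chartDeriv_symmL hy]
    rfl
  have hmem : y ∈ (trivializationAt (𝔼 →L[ℝ] ℝ) (fun x : M => Covector n x) c).baseSet := by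
    rw [hom_trivializationAt_baseSet]
    exact ⟨by simpa using hy, trivial⟩
  simp only [ContinuousLinearMap.inCoordinates, ContinuousLinearMap.comp_apply]
  rw [h1, Trivialization.continuousLinearMapAt_apply, Trivialization.coe_linearMapAt_of_mem _ hmem]
  exact congrArg Prod.snd (trivializationAt_covectorOfChart hy (B a))

/-- Passing from coordinates in a fixed chart to the bundle of jets is continuous. -/
theorem continuousOn_coJetOfChart (c : M) :
    ContinuousOn (fun q : M × (𝔼 →L[ℝ] ℝ) × (𝔼 →L[ℝ] 𝔼 →L[ℝ] ℝ) =>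
      (⟨q.1, (covectorOfChart c q.1 q.2.1, bilinFormOfChart c q.1 q.2.2)⟩ : CoJetBundle n M))
      {q | q.1 ∈ (chartAt 𝔼 c).source} := by
  have hind := FiberBundle.Prod.isInducing_diag (𝔼 →L[ℝ] ℝ) (fun x : M => Covector n x)
    (𝔼 →L[ℝ] 𝔼 →L[ℝ] ℝ) (fun x : M => BilinForm n x)
  rw [hind.continuousOn_iff]
  refine ContinuousOn.prodMk ?_ ?_
  · set e := trivializationAt (𝔼 →L[ℝ] ℝ) (fun x : M => Covector n x) c
    have hmem : ∀ y ∈ (chartAt 𝔼 c).source, y ∈ e.baseSet := fun y hy => by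
      rw [hom_trivializationAt_baseSet]
      exact ⟨by simpa using hy, trivial⟩
    have h1 : ContinuousOn (fun q : M × (𝔼 →L[ℝ] ℝ) × (𝔼 →L[ℝ] 𝔼 →L[ℝ] ℝ) =>
        e.toOpenPartialHomeomorph.symm (q.1, q.2.1)) {q | q.1 ∈ (chartAt 𝔼 c).source} :=
      e.toOpenPartialHomeomorph.continuousOn_symm.comp (by fun_prop)
        fun q hq => e.mem_target.2 (hmem _ hq)
    refine h1.congr fun q hq => ?_
    simp only
    rw [← trivializationAt_covectorOfChart hq]
    exact (e.toOpenPartialHomeomorph.left_inv (e.mem_source.2 (hmem q.1 hq))).symm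
  · set e := trivializationAt (𝔼 →L[ℝ] 𝔼 →L[ℝ] ℝ) (fun x : M => BilinForm n x) c
    have hmem : ∀ y ∈ (chartAt 𝔼 c).source, y ∈ e.baseSet := fun y hy => by
      rw [hom_trivializationAt_baseSet, hom_trivializationAt_baseSet]
      exact ⟨by simpa using hy, by simpa using hy, trivial⟩
    have h1 : ContinuousOn (fun q : M × (𝔼 →L[ℝ] ℝ) × (𝔼 →L[ℝ] 𝔼 →L[ℝ] ℝ) =>
        e.toOpenPartialHomeomorph.symm (q.1, q.2.2)) {q | q.1 ∈ (chartAt 𝔼 c).source} :=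
      e.toOpenPartialHomeomorph.continuousOn_symm.comp (by fun_prop)
        fun q hq => e.mem_target.2 (hmem _ hq)
    refine h1.congr fun q hq => ?_
    simp only
    rw [← trivializationAt_bilinFormOfChart hq]
    exact (e.toOpenPartialHomeomorph.left_inv (e.mem_source.2 (hmem q.1 hq))).symm

end Bundle

/-! ### Functions of class C^{1,2} in a chart -/

section C12

/-- The function `φ t`, read in the chart at `c`. -/
def chartFun (c : M) (φ : ℝ → M → ℝ) (t : ℝ) (v : 𝔼) : ℝ := φ t ((extChartAt (𝓡 n) c).symm v)

/-- The set `U`, read in the chart at `c`. -/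
def chartRegion (c : M) (U : Set (ℝ × M)) : Set (ℝ × 𝔼) :=
  {q | q.2 ∈ (extChartAt (𝓡 n) c).target ∧ (q.1, (extChartAt (𝓡 n) c).symm q.2) ∈ U}

theorem isOpen_chartRegion (c : M) {U : Set (ℝ × M)} (hU : IsOpen U) :
    IsOpen (chartRegion (n := n) c U) := by
  have h1 : IsOpen {q : ℝ × 𝔼 | q.2 ∈ (extChartAt (𝓡 n) c).target} :=
    (isOpen_extChartAt_target c).preimage continuous_snd
  have h2 : ContinuousOn (fun q : ℝ × 𝔼 => (q.1, (extChartAt (𝓡 n) c).symm q.2))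
      {q : ℝ × 𝔼 | q.2 ∈ (extChartAt (𝓡 n) c).target} :=
    continuousOn_fst.prodMk
      ((continuousOn_extChartAt_symm c).comp continuousOn_snd fun q hq => hq)
  exact h2.isOpen_inter_preimage h1 hU

theorem mem_chartRegion {c : M} {U : Set (ℝ × M)} {z : ℝ × M} (hz : z ∈ U)
    (hc : z.2 ∈ (extChartAt (𝓡 n) c).source) :
    (z.1, extChartAt (𝓡 n) c z.2) ∈ chartRegion c U := by
  refine ⟨(extChartAt (𝓡 n) c).map_source hc, ?_⟩
  simp only [(extChartAt (𝓡 n) c).left_inv hc]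
  exact hz

namespace IsC12On

variable {φ φ₁ φ₂ : ℝ → M → ℝ} {U U' : Set (ℝ × M)}

theorem mono (h : IsC12On n φ U) (hU : U' ⊆ U) : IsC12On n φ U' := by
  intro c
  obtain ⟨h1, h2, h3, h4, h5⟩ := h c
  have hs : chartRegion (n := n) c U' ⊆ chartRegion c U := fun q hq => ⟨hq.1, hU hq.2⟩
  exact ⟨fun q hq => h1 q (hs hq), h2.mono hs, h3.mono hs, h4.mono hs, h5.mono hs⟩

theorem differentiableAt_time (h : IsC12On n φ U) {z : ℝ × M} (hz : z ∈ U) :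
    DifferentiableAt ℝ (fun s => φ s z.2) z.1 := by
  have h1 := ((h z.2).1 _ (mem_chartRegion hz (mem_extChartAt_source z.2))).1
  simpa using h1

theorem eventually_differentiableAt (h : IsC12On n φ U) (hU : IsOpen U) {c : M} {z : ℝ × M}
    (hz : z ∈ U) (hc : z.2 ∈ (extChartAt (𝓡 n) c).source) :
    ∀ᶠ w in 𝓝 (extChartAt (𝓡 n) c z.2), DifferentiableAt ℝ (chartFun (n := n) c φ z.1) w := by
  have h1 : ∀ᶠ w in 𝓝 (extChartAt (𝓡 n) c z.2), (z.1, w) ∈ chartRegion (n := n) c U :=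
    (Continuous.prodMk_right z.1).continuousAt.eventually
      ((isOpen_chartRegion c hU).mem_nhds (mem_chartRegion hz hc))
  filter_upwards [h1] with w hw
  exact ((h c).1 _ hw).2.1

theorem differentiableAt_fderiv (h : IsC12On n φ U) {c : M} {z : ℝ × M} (hz : z ∈ U)
    (hc : z.2 ∈ (extChartAt (𝓡 n) c).source) :
    DifferentiableAt ℝ (fderiv ℝ (chartFun (n := n) c φ z.1)) (extChartAt (𝓡 n) c z.2) :=
  ((h c).1 _ (mem_chartRegion hz hc)).2.2

theorem fderiv_fderiv_comm (h : IsC12On n φ U) (hU : IsOpen U) {c : M} {z : ℝ × M} (hz : z ∈ U)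
    (hc : z.2 ∈ (extChartAt (𝓡 n) c).source) (a b : 𝔼) :
    fderiv ℝ (fderiv ℝ (chartFun (n := n) c φ z.1)) (extChartAt (𝓡 n) c z.2) a b =
      fderiv ℝ (fderiv ℝ (chartFun (n := n) c φ z.1)) (extChartAt (𝓡 n) c z.2) b a :=
  second_derivative_symmetric_of_eventually
    ((h.eventually_differentiableAt hU hz hc).mono fun _ hw => hw.hasFDerivAt)
    (h.differentiableAt_fderiv hz hc).hasFDerivAt a b

theorem continuousOn (h : IsC12On n φ U) (hU : IsOpen U) :
    ContinuousOn (fun z : ℝ × M => φ z.1 z.2) U := by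
  intro z hz
  refine ContinuousAt.continuousWithinAt ?_
  have hc := mem_extChartAt_source (I := 𝓡 n) z.2
  have h1 := (h z.2).2.1.continuousAt ((isOpen_chartRegion z.2 hU).mem_nhds (mem_chartRegion hz hc))
  have h2 : ContinuousAt (fun w : ℝ × M => (w.1, extChartAt (𝓡 n) z.2 w.2)) z :=
    continuousAt_fst.prodMk ((continuousAt_extChartAt z.2).comp continuousAt_snd)
  have h3 := ContinuousAt.comp (f := fun w : ℝ × M => (w.1, extChartAt (𝓡 n) z.2 w.2)) h1 h2
  refine h3.congr ?_
  filter_upwards [continuousAt_snd.eventually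
    ((isOpen_extChartAt_source (I := 𝓡 n) z.2).mem_nhds hc)] with w hw
  exact congrArg (φ w.1) ((extChartAt (𝓡 n) z.2).left_inv hw)

theorem eventually_fderiv_add (h₁ : IsC12On n φ₁ U) (h₂ : IsC12On n φ₂ U) (hU : IsOpen U) {c : M}
    {q : ℝ × 𝔼} (hq : q ∈ chartRegion c U) :
    fderiv ℝ (chartFun c (fun s y => φ₁ s y + φ₂ s y) q.1) =ᶠ[𝓝 q.2]
      fderiv ℝ (chartFun c φ₁ q.1) + fderiv ℝ (chartFun c φ₂ q.1) := by
  have h1 : ∀ᶠ w in 𝓝 q.2, (q.1, w) ∈ chartRegion (n := n) c U :=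
    (Continuous.prodMk_right q.1).continuousAt.eventually ((isOpen_chartRegion c hU).mem_nhds hq)
  filter_upwards [h1] with w hw
  exact fderiv_add ((h₁ c).1 _ hw).2.1 ((h₂ c).1 _ hw).2.1

theorem fderiv_fderiv_add (h₁ : IsC12On n φ₁ U) (h₂ : IsC12On n φ₂ U) (hU : IsOpen U) {c : M}
    {q : ℝ × 𝔼} (hq : q ∈ chartRegion c U) :
    fderiv ℝ (fderiv ℝ (chartFun c (fun s y => φ₁ s y + φ₂ s y) q.1)) q.2 =
      fderiv ℝ (fderiv ℝ (chartFun c φ₁ q.1)) q.2 +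
        fderiv ℝ (fderiv ℝ (chartFun c φ₂ q.1)) q.2 := by
  rw [(h₁.eventually_fderiv_add h₂ hU hq).fderiv_eq]
  exact fderiv_add ((h₁ c).1 _ hq).2.2 ((h₂ c).1 _ hq).2.2

theorem add (h₁ : IsC12On n φ₁ U) (h₂ : IsC12On n φ₂ U) (hU : IsOpen U) :
    IsC12On n (fun s y => φ₁ s y + φ₂ s y) U := by
  intro c
  obtain ⟨a1, a2, a3, a4, a5⟩ := h₁ c
  obtain ⟨b1, b2, b3, b4, b5⟩ := h₂ c
  refine ⟨fun q hq => ⟨(a1 q hq).1.add (b1 q hq).1, (a1 q hq).2.1.add (b1 q hq).2.1, ?_⟩,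
    a2.add b2, (a3.add b3).congr fun q hq => ?_, (a4.add b4).congr fun q hq => ?_,
    (a5.add b5).congr fun q hq => ?_⟩
  · exact ((a1 q hq).2.2.add (b1 q hq).2.2).congr_of_eventuallyEq
      (h₁.eventually_fderiv_add h₂ hU hq)
  · exact deriv_add (a1 q hq).1 (b1 q hq).1
  · exact fderiv_add (a1 q hq).2.1 (b1 q hq).2.1
  · exact h₁.fderiv_fderiv_add h₂ hU hq

/-- A smooth function of time and the coordinates of one chart is of class `C^{1,2}`. The definition
of the class refers to all charts, and the second derivatives in another chart involve those of the
coordinate change. -/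
theorem of_contDiff (c : M) {q : ℝ × 𝔼 → ℝ} (hq : ContDiff ℝ ∞ q) :
    IsC12On n (fun s y => q (s, extChartAt (𝓡 n) c y))
      {z : ℝ × M | z.2 ∈ (extChartAt (𝓡 n) c).source} := by
  intro c'
  set V : Set (ℝ × 𝔼) := {p | p.2 ∈ transitionDomain c' c} with hVdef
  have hV : IsOpen V := (isOpen_transitionDomain c' c).preimage continuous_snd
  have hf : ContDiffOn ℝ ∞ (fun p : ℝ × 𝔼 => q (p.1, transition c' c p.2)) V :=
    hq.comp_contDiffOn (contDiffOn_fst.prodMk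
      ((contDiffOn_transition c' c).comp contDiffOn_snd fun p hp => hp))
  have hD := contDiffOn_partial_snd hV hf
  have hDD := contDiffOn_partial_snd hV hD
  obtain ⟨ht1, ht2⟩ := contDiffOn_partial_fst hV hf
  refine ⟨fun p hp => ⟨ht1 p hp, ?_, ?_⟩, hf.continuousOn, ht2, hD.continuousOn, hDD.continuousOn⟩
  · exact (hasFDerivAt_partial_snd
      ((hf.contDiffAt (hV.mem_nhds hp)).differentiableAt (by simp))).differentiableAt
  · exact (hasFDerivAt_partial_snd
      ((hD.contDiffAt (hV.mem_nhds hp)).differentiableAt (by simp))).differentiableAt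

end IsC12On

end C12

/-! ### The parabolic operator in a chart -/

section Operator

variable [IsContMDiffRiemannianBundle (𝓡 n) ∞ (EuclideanSpace ℝ (Fin n))
      (fun x : M => TangentSpace (𝓡 n) x)]

/-- The coordinates in the chart at `c` of the Hessian of a function with first and second
coordinate derivatives `ξ` and `B` at `y`. -/
def chartHess (c y : M) (ξ : 𝔼 →L[ℝ] ℝ) (B : 𝔼 →L[ℝ] 𝔼 →L[ℝ] ℝ) : 𝔼 →L[ℝ] 𝔼 →L[ℝ] ℝ :=
  B - (ContinuousLinearMap.compL ℝ 𝔼 𝔼 ℝ ξ).comp (christoffelL c (extChartAt (𝓡 n) c y))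

theorem chartHess_apply {c y : M} (hy : y ∈ (extChartAt (𝓡 n) c).source) (ξ : 𝔼 →L[ℝ] ℝ)
    (B : 𝔼 →L[ℝ] 𝔼 →L[ℝ] ℝ) (a b : 𝔼) :
    chartHess c y ξ B a b = B a b - ξ (christoffel c (extChartAt (𝓡 n) c y) a b) := by
  rw [← christoffelL_apply ((extChartAt (𝓡 n) c).map_source hy)]
  rfl

/-- The nonlinearity in the chart at `c`, as a function of the first and second coordinate
derivatives. -/
def chartNonlinearity (F : Nonlinearity n M) (c : M) (t : ℝ) (y : M) (r : ℝ) (ξ : 𝔼 →L[ℝ] ℝ)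
    (B : 𝔼 →L[ℝ] 𝔼 →L[ℝ] ℝ) : ℝ :=
  F t y r (covectorOfChart c y ξ) (bilinFormOfChart c y (chartHess c y ξ B))

theorem isSymmForm_chartHess {c y : M} (hy : y ∈ (extChartAt (𝓡 n) c).source) (ξ : 𝔼 →L[ℝ] ℝ)
    {B : 𝔼 →L[ℝ] 𝔼 →L[ℝ] ℝ} (hB : ∀ a b, B a b = B b a) :
    IsSymmForm (bilinFormOfChart c y (chartHess c y ξ B)) := by
  intro X Y
  rw [bilinFormOfChart_apply, bilinFormOfChart_apply, chartHess_apply hy, chartHess_apply hy, hB,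
    christoffel_comm ((extChartAt (𝓡 n) c).map_source hy)]

theorem continuousOn_chartNonlinearity {T : ℝ} {F : Nonlinearity n M}
    (hF : IsContinuousNonlinearity T F) (c : M) :
    ContinuousOn (fun q : ℝ × M × ℝ × (𝔼 →L[ℝ] ℝ) × (𝔼 →L[ℝ] 𝔼 →L[ℝ] ℝ) =>
      chartNonlinearity F c q.1 q.2.1 q.2.2.1 q.2.2.2.1 q.2.2.2.2)
      {q | q.1 ∈ Icc 0 T ∧ q.2.1 ∈ (extChartAt (𝓡 n) c).source ∧
        ∀ a b, q.2.2.2.2 a b = q.2.2.2.2 b a} := by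
  set S : Set (ℝ × M × ℝ × (𝔼 →L[ℝ] ℝ) × (𝔼 →L[ℝ] 𝔼 →L[ℝ] ℝ)) :=
    {q | q.1 ∈ Icc 0 T ∧ q.2.1 ∈ (extChartAt (𝓡 n) c).source ∧
      ∀ a b, q.2.2.2.2 a b = q.2.2.2.2 b a} with hS
  have hy : ContinuousOn (fun q : ℝ × M × ℝ × (𝔼 →L[ℝ] ℝ) × (𝔼 →L[ℝ] 𝔼 →L[ℝ] ℝ) => q.2.1) S :=
    (continuous_fst.comp continuous_snd).continuousOn
  have hξ : ContinuousOn
      (fun q : ℝ × M × ℝ × (𝔼 →L[ℝ] ℝ) × (𝔼 →L[ℝ] 𝔼 →L[ℝ] ℝ) => q.2.2.2.1) S :=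
    (continuous_fst.comp (continuous_snd.comp (continuous_snd.comp continuous_snd))).continuousOn
  have hB : ContinuousOn
      (fun q : ℝ × M × ℝ × (𝔼 →L[ℝ] ℝ) × (𝔼 →L[ℝ] 𝔼 →L[ℝ] ℝ) => q.2.2.2.2) S :=
    (continuous_snd.comp (continuous_snd.comp (continuous_snd.comp continuous_snd))).continuousOn
  have hΓ : ContinuousOn (fun q : ℝ × M × ℝ × (𝔼 →L[ℝ] ℝ) × (𝔼 →L[ℝ] 𝔼 →L[ℝ] ℝ) =>
      christoffelL c (extChartAt (𝓡 n) c q.2.1)) S :=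
    (continuousOn_christoffelL c).comp
      ((continuousOn_extChartAt c).comp hy fun q hq => hq.2.1)
      fun q hq => (extChartAt (𝓡 n) c).map_source hq.2.1
  have hH : ContinuousOn (fun q : ℝ × M × ℝ × (𝔼 →L[ℝ] ℝ) × (𝔼 →L[ℝ] 𝔼 →L[ℝ] ℝ) =>
      chartHess c q.2.1 q.2.2.2.1 q.2.2.2.2) S :=
    hB.sub (((ContinuousLinearMap.compL ℝ 𝔼 𝔼 ℝ).continuous.comp_continuousOn hξ).clm_comp hΓ)
  have hJ := (continuousOn_coJetOfChart (n := n) c).comp (hy.prodMk (hξ.prodMk hH))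
    fun q hq => by simpa using hq.2.1
  exact ContinuousOn.comp hF
    (continuousOn_fst.prodMk (((continuous_fst.comp
      (continuous_snd.comp continuous_snd)).continuousOn (s := S)).prodMk hJ))
    fun q hq => ⟨hq.1, isSymmForm_chartHess hq.2.1 _ hq.2.2⟩

/-- The value of `φ_t + F(t, y, r, dφ, d²φ)` at `z = (t, y)`, computed in the chart at `c`. -/
def chartOperator (F : Nonlinearity n M) (c : M) (φ : ℝ → M → ℝ) (z : ℝ × M) (r : ℝ) : ℝ :=
  deriv (fun s => φ s z.2) z.1 + chartNonlinearity F c z.1 z.2 r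
    (fderiv ℝ (chartFun c φ z.1) (extChartAt (𝓡 n) c z.2))
    (fderiv ℝ (fderiv ℝ (chartFun c φ z.1)) (extChartAt (𝓡 n) c z.2))

variable {φ φ₁ φ₂ : ℝ → M → ℝ} {U : Set (ℝ × M)} {c : M} {z : ℝ × M}

theorem mvfderiv_eq_covectorOfChart (hφ : IsC12On n φ U) (hU : IsOpen U) (hz : z ∈ U)
    (hc : z.2 ∈ (extChartAt (𝓡 n) c).source) :
    mvfderiv (𝓡 n) (φ z.1) z.2 =
      covectorOfChart c z.2 (fderiv ℝ (chartFun c φ z.1) (extChartAt (𝓡 n) c z.2)) := by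
  have h1 : φ z.1 =ᶠ[𝓝 z.2] chartFun c φ z.1 ∘ extChartAt (𝓡 n) c := by
    filter_upwards [(isOpen_extChartAt_source (I := 𝓡 n) c).mem_nhds hc] with y hy
    exact (congrArg (φ z.1) ((extChartAt (𝓡 n) c).left_inv hy)).symm
  have h2 := (hφ.eventually_differentiableAt hU hz hc).self_of_nhds
  have h3 : MDifferentiableAt (𝓡 n) 𝓘(ℝ, 𝔼) (extChartAt (𝓡 n) c) z.2 :=
    mdifferentiableAt_extChartAt (by simpa using hc)
  have h4 := mfderiv_comp z.2 h2.mdifferentiableAt h3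
  rw [mfderiv_eq_fderiv] at h4
  have h5 := h1.mfderiv_eq (I := 𝓡 n) (I' := 𝓘(ℝ, ℝ))
  refine ContinuousLinearMap.ext fun X => ?_
  have h6 := DFunLike.congr_fun (h5.trans h4) X
  exact h6

/-- The jet of a test function, computed in any chart around the point. -/
theorem isJetOf_iff (hφ : IsC12On n φ U) (hU : IsOpen U) (hz : z ∈ U)
    (hc : z.2 ∈ (extChartAt (𝓡 n) c).source) {p : ℝ} {ζ : Covector n z.2} {A : BilinForm n z.2} :
    IsJetOf φ z.1 z.2 p ζ A ↔ p = deriv (fun s => φ s z.2) z.1 ∧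
      ζ = covectorOfChart c z.2 (fderiv ℝ (chartFun c φ z.1) (extChartAt (𝓡 n) c z.2)) ∧
      A = bilinFormOfChart c z.2
        (chartHess c z.2 (fderiv ℝ (chartFun c φ z.1) (extChartAt (𝓡 n) c z.2))
          (fderiv ℝ (fderiv ℝ (chartFun c φ z.1)) (extChartAt (𝓡 n) c z.2))) := by
  have hH : ∀ X Y : TangentSpace (𝓡 n) z.2, hessian (φ z.1) z.2 X Y = bilinFormOfChart c z.2
        (chartHess c z.2 (fderiv ℝ (chartFun c φ z.1) (extChartAt (𝓡 n) c z.2))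
          (fderiv ℝ (fderiv ℝ (chartFun c φ z.1)) (extChartAt (𝓡 n) c z.2))) X Y := by
    intro X Y
    have h1 := hessianInChart_eq_hessianInChart (mem_extChartAt_source (I := 𝓡 n) z.2) hc
      (f := φ z.1) (hφ.eventually_differentiableAt hU hz hc) (hφ.differentiableAt_fderiv hz hc) X Y
    rw [hessian, h1, bilinFormOfChart_apply, chartHess_apply hc]
    rfl
  rw [IsJetOf, mvfderiv_eq_covectorOfChart hφ hU hz hc]
  refine and_congr_right fun _ => and_congr_right fun _ => ⟨fun h => ?_, fun h X Y => ?_⟩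
  · exact ContinuousLinearMap.ext fun X => ContinuousLinearMap.ext fun Y => (h X Y).trans (hH X Y)
  · rw [h, hH]

theorem IsJetOf.eq_chartOperator (F : Nonlinearity n M) (hφ : IsC12On n φ U) (hU : IsOpen U)
    (hz : z ∈ U) (hc : z.2 ∈ (extChartAt (𝓡 n) c).source) {p : ℝ} {ζ : Covector n z.2}
    {A : BilinForm n z.2} (h : IsJetOf φ z.1 z.2 p ζ A) (r : ℝ) :
    p + F z.1 z.2 r ζ A = chartOperator F c φ z r := by
  obtain ⟨rfl, rfl, rfl⟩ := (isJetOf_iff hφ hU hz hc).1 h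
  rfl

/-- The operator applied to a fixed test function is continuous. The range of times is `[0, T]`
since `F` is continuous there only. -/
theorem continuousOn_chartOperator {T : ℝ} {F : Nonlinearity n M}
    (hF : IsContinuousNonlinearity T F) (hφ : IsC12On n φ U) (hU : IsOpen U) :
    ContinuousOn (fun q : (ℝ × M) × ℝ => chartOperator F c φ q.1 q.2)
      {q | q.1 ∈ U ∧ q.1.1 ∈ Icc 0 T ∧ q.1.2 ∈ (extChartAt (𝓡 n) c).source} := by
  set S : Set ((ℝ × M) × ℝ) :=
    {q | q.1 ∈ U ∧ q.1.1 ∈ Icc 0 T ∧ q.1.2 ∈ (extChartAt (𝓡 n) c).source} with hS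
  have h1 : ContinuousOn (fun q : (ℝ × M) × ℝ => (q.1.1, extChartAt (𝓡 n) c q.1.2)) S :=
    (continuous_fst.comp continuous_fst).continuousOn.prodMk
      ((continuousOn_extChartAt c).comp (continuous_snd.comp continuous_fst).continuousOn
        fun q hq => hq.2.2)
  have hm : MapsTo (fun q : (ℝ × M) × ℝ => (q.1.1, extChartAt (𝓡 n) c q.1.2)) S
      (chartRegion c U) := fun q hq => mem_chartRegion hq.1 hq.2.2
  obtain ⟨-, -, c3, c4, c5⟩ := hφ c
  have d1 : ContinuousOn (fun q : (ℝ × M) × ℝ => deriv (fun s => φ s q.1.2) q.1.1) S := by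
    refine (c3.comp h1 hm).congr fun q hq => ?_
    simp only [Function.comp_apply, (extChartAt (𝓡 n) c).left_inv hq.2.2]
  have d2 := c4.comp h1 hm
  have d3 := c5.comp h1 hm
  refine d1.add ?_
  exact (continuousOn_chartNonlinearity hF c).comp
    ((continuous_fst.comp continuous_fst).continuousOn.prodMk
      ((continuous_snd.comp continuous_fst).continuousOn.prodMk
        (continuous_snd.continuousOn.prodMk (d2.prodMk d3))))
    fun q hq => ⟨hq.2.1, hq.2.2, fun a b => hφ.fderiv_fderiv_comm hU hq.1 hq.2.2 a b⟩

/-- For equal first derivatives, the order of the Hessians is that of the second coordinate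
derivatives, since the terms with Christoffel symbols are the same. -/
theorem chartNonlinearity_anti {T : ℝ} {F : Nonlinearity n M} (hF : IsDegenerateElliptic T F)
    {t : ℝ} (ht : t ∈ Ioo 0 T) {y : M} (hy : y ∈ (extChartAt (𝓡 n) c).source) (r : ℝ)
    (ξ : 𝔼 →L[ℝ] ℝ) {B B' : 𝔼 →L[ℝ] 𝔼 →L[ℝ] ℝ} (hB : ∀ a b, B a b = B b a)
    (hB' : ∀ a b, B' a b = B' b a) (h : ∀ a, B a a ≤ B' a a) :
    chartNonlinearity F c t y r ξ B' ≤ chartNonlinearity F c t y r ξ B := by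
  refine hF t ht y r _ _ _ (isSymmForm_chartHess hy ξ hB) (isSymmForm_chartHess hy ξ hB')
    fun X => ?_
  rw [bilinFormOfChart_apply, bilinFormOfChart_apply, chartHess_apply hy, chartHess_apply hy]
  linarith [h (chartDeriv c y X)]

theorem chartNonlinearity_zero (F : Nonlinearity n M) (c : M) (t : ℝ) (y : M) (r : ℝ) :
    chartNonlinearity F c t y r 0 0 = F t y r 0 0 := by
  have h1 : covectorOfChart (n := n) c y 0 = 0 := rfl
  have h2 : bilinFormOfChart (n := n) c y (chartHess c y 0 0) = 0 := by
    have : chartHess (n := n) c y 0 0 = 0 := by simp [chartHess]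
    rw [this]
    rfl
  rw [chartNonlinearity, h1, h2]

/-- Ellipticity at a contact point of `φ₁ t` and `φ₂ t`. -/
theorem chartNonlinearity_le_of_touching {T : ℝ} {F : Nonlinearity n M}
    (hF : IsDegenerateElliptic T F) (ht : z.1 ∈ Ioo 0 T) (h₁ : IsC12On n φ₁ U)
    (h₂ : IsC12On n φ₂ U) (hU : IsOpen U) (hz : z ∈ U)
    (hc : z.2 ∈ (extChartAt (𝓡 n) c).source) (heq : φ₁ z.1 z.2 = φ₂ z.1 z.2)
    (hle : ∀ᶠ y in 𝓝 z.2, φ₁ z.1 y ≤ φ₂ z.1 y) (r : ℝ) :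
    chartNonlinearity F c z.1 z.2 r
        (fderiv ℝ (chartFun c φ₂ z.1) (extChartAt (𝓡 n) c z.2))
        (fderiv ℝ (fderiv ℝ (chartFun c φ₂ z.1)) (extChartAt (𝓡 n) c z.2)) ≤
      chartNonlinearity F c z.1 z.2 r
        (fderiv ℝ (chartFun c φ₁ z.1) (extChartAt (𝓡 n) c z.2))
        (fderiv ℝ (fderiv ℝ (chartFun c φ₁ z.1)) (extChartAt (𝓡 n) c z.2)) := by
  set v := extChartAt (𝓡 n) c z.2 with hv
  have hvt : v ∈ (extChartAt (𝓡 n) c).target := (extChartAt (𝓡 n) c).map_source hc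
  have hinv : (extChartAt (𝓡 n) c).symm v = z.2 := (extChartAt (𝓡 n) c).left_inv hc
  set g₁ : 𝔼 → ℝ := chartFun c φ₁ z.1 with hg₁
  set g₂ : 𝔼 → ℝ := chartFun c φ₂ z.1 with hg₂
  have e1 := h₁.eventually_differentiableAt hU hz hc
  have e2 := h₂.eventually_differentiableAt hU hz hc
  have hmin : IsLocalMin (g₂ - g₁) v := by
    have hcont : Tendsto (extChartAt (𝓡 n) c).symm (𝓝 v) (𝓝 z.2) := by
      have h4 : ContinuousAt (extChartAt (𝓡 n) c).symm v := continuousAt_extChartAt_symm'' hvt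
      rwa [ContinuousAt, hinv] at h4
    filter_upwards [hcont.eventually hle] with w hw
    simp only [Pi.sub_apply, hg₁, hg₂, chartFun, hinv, heq, sub_self]
    exact sub_nonneg.2 hw
  have hDev : fderiv ℝ (g₂ - g₁) =ᶠ[𝓝 v] fderiv ℝ g₂ - fderiv ℝ g₁ := by
    filter_upwards [e1, e2] with w hw1 hw2
    exact fderiv_sub hw2 hw1
  have hD : fderiv ℝ g₂ v = fderiv ℝ g₁ v := by
    have h5 := hmin.fderiv_eq_zero
    rw [hDev.eq_of_nhds] at h5
    exact sub_eq_zero.1 h5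
  have hDD : fderiv ℝ (fderiv ℝ (g₂ - g₁)) v =
      fderiv ℝ (fderiv ℝ g₂) v - fderiv ℝ (fderiv ℝ g₁) v := by
    rw [hDev.fderiv_eq]
    exact fderiv_sub (h₂.differentiableAt_fderiv hz hc) (h₁.differentiableAt_fderiv hz hc)
  have hpos : ∀ a, fderiv ℝ (fderiv ℝ g₁) v a a ≤ fderiv ℝ (fderiv ℝ g₂) v a a := by
    intro a
    have h6 := nonneg_of_isLocalMin hmin
      (by filter_upwards [e1, e2] with w hw1 hw2 using hw2.sub hw1)
      (((h₂.differentiableAt_fderiv hz hc).sub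
        (h₁.differentiableAt_fderiv hz hc)).congr_of_eventuallyEq hDev) a
    rw [hDD] at h6
    simpa using h6
  rw [hD]
  exact chartNonlinearity_anti hF ht hc r _ (fun a b => h₁.fderiv_fderiv_comm hU hz hc a b)
    (fun a b => h₂.fderiv_fderiv_comm hU hz hc a b) hpos

/-- Ellipticity at a contact point: a function that touches `φ₁` from above has the smaller value
of the operator. -/
theorem chartOperator_le_of_touching {T : ℝ} {F : Nonlinearity n M} (hF : IsDegenerateElliptic T F)
    (ht : z.1 ∈ Ioo 0 T) (h₁ : IsC12On n φ₁ U) (h₂ : IsC12On n φ₂ U) (hU : IsOpen U) (hz : z ∈ U)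
    (hc : z.2 ∈ (extChartAt (𝓡 n) c).source) (heq : φ₁ z.1 z.2 = φ₂ z.1 z.2)
    (hle : ∀ᶠ q : ℝ × M in 𝓝 z, φ₁ q.1 q.2 ≤ φ₂ q.1 q.2) (r : ℝ) :
    chartOperator F c φ₂ z r ≤ chartOperator F c φ₁ z r := by
  have ht' : deriv (fun s => φ₂ s z.2) z.1 = deriv (fun s => φ₁ s z.2) z.1 := by
    have hmin : IsLocalMin (fun s => φ₂ s z.2 - φ₁ s z.2) z.1 := by
      filter_upwards [(Continuous.prodMk_left z.2).continuousAt.eventually hle] with s hs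
      rw [heq, sub_self]
      exact sub_nonneg.2 hs
    have h3 := hmin.deriv_eq_zero
    rw [deriv_fun_sub (h₂.differentiableAt_time hz) (h₁.differentiableAt_time hz)] at h3
    linarith
  rw [chartOperator, chartOperator, ht']
  gcongr
  exact chartNonlinearity_le_of_touching hF ht h₁ h₂ hU hz hc heq
    ((Continuous.prodMk_right z.1).continuousAt.eventually hle) r

end Operator

/-! ### Perturbation of test functions, and solutions in terms of the operator -/

section Perturbation

theorem IsC12On.const (a : ℝ) (U : Set (ℝ × M)) : IsC12On n (fun _ _ => a) U := by
  intro c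
  have h0 : fderiv ℝ (fun _ : 𝔼 => a) = fun _ => 0 := by
    funext v
    simp
  refine ⟨fun q _ => ⟨differentiableAt_const _, differentiableAt_const _, ?_⟩, continuousOn_const,
    ?_, ?_, ?_⟩
  · simp only [h0]
    exact differentiableAt_const _
  · simpa using continuousOn_const
  · simp only [h0]
    exact continuousOn_const
  · simp only [h0]
    simpa using continuousOn_const

/-- The function `(s - t)² + |y - x|⁴` in the coordinates of the chart at `c`, where `z = (t, x)`.
It vanishes only at `z`, and its jet at `z` is zero. -/
def quartic (c : M) (z : ℝ × M) (s : ℝ) (y : M) : ℝ :=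
  (s - z.1) ^ 2 + (‖extChartAt (𝓡 n) c y - extChartAt (𝓡 n) c z.2‖ ^ 2) ^ 2

variable {c : M} {z : ℝ × M}

theorem quartic_self : quartic (n := n) c z z.1 z.2 = 0 := by simp [quartic]

theorem quartic_nonneg (s : ℝ) (y : M) : 0 ≤ quartic (n := n) c z s y := by
  unfold quartic
  positivity

theorem quartic_pos (hc : z.2 ∈ (extChartAt (𝓡 n) c).source) {q : ℝ × M}
    (hq : q.2 ∈ (extChartAt (𝓡 n) c).source) (hne : q ≠ z) :
    0 < quartic (n := n) c z q.1 q.2 := by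
  refine (quartic_nonneg _ _).lt_of_ne fun h0 => hne ?_
  have h1 : (q.1 - z.1) ^ 2 = 0 := by
    have : 0 ≤ (‖extChartAt (𝓡 n) c q.2 - extChartAt (𝓡 n) c z.2‖ ^ 2) ^ 2 := by positivity
    have h2 := sq_nonneg (q.1 - z.1)
    unfold quartic at h0
    linarith
  have h2 : (‖extChartAt (𝓡 n) c q.2 - extChartAt (𝓡 n) c z.2‖ ^ 2) ^ 2 = 0 := by
    unfold quartic at h0
    linarith
  refine Prod.ext (sub_eq_zero.1 (by simpa using h1)) ((extChartAt (𝓡 n) c).injOn hq hc ?_)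
  simpa [sub_eq_zero] using h2

theorem IsC12On.smul_quartic (σ : ℝ) :
    IsC12On n (fun s y => σ * quartic (n := n) c z s y)
      {q : ℝ × M | q.2 ∈ (extChartAt (𝓡 n) c).source} :=
  IsC12On.of_contDiff c
    (q := fun p => σ * ((p.1 - z.1) ^ 2 + (‖p.2 - extChartAt (𝓡 n) c z.2‖ ^ 2) ^ 2))
    (contDiff_const.mul (((contDiff_fst.sub contDiff_const).pow 2).add
      (((contDiff_snd.sub contDiff_const).norm_sq ℝ).pow 2)))

theorem hasDerivAt_smul_quartic (σ : ℝ) :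
    HasDerivAt (fun s => σ * quartic (n := n) c z s z.2) 0 z.1 := by
  have h := ((((hasDerivAt_id z.1).sub_const z.1).pow 2).add_const
    ((‖extChartAt (𝓡 n) c z.2 - extChartAt (𝓡 n) c z.2‖ ^ 2) ^ 2)).const_mul σ
  refine h.congr_deriv ?_
  simp

theorem fderiv_norm_sub_pow_four (v₀ : 𝔼) :
    fderiv ℝ (fun v : 𝔼 => (‖v - v₀‖ ^ 2) ^ 2) v₀ = 0 ∧
      fderiv ℝ (fderiv ℝ (fun v : 𝔼 => (‖v - v₀‖ ^ 2) ^ 2)) v₀ = 0 := by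
  have h1 : ∀ v, HasFDerivAt (fun v : 𝔼 => ‖v - v₀‖ ^ 2)
      (2 • (innerSL ℝ (v - v₀)).comp (ContinuousLinearMap.id ℝ 𝔼)) v := fun v =>
    ((hasFDerivAt_id v).sub_const v₀).norm_sq
  have h2 : ∀ v, HasFDerivAt (fun v : 𝔼 => (‖v - v₀‖ ^ 2) ^ 2)
      ((4 * ‖v - v₀‖ ^ 2) • innerSL ℝ (v - v₀)) v := fun v => by
    refine ((h1 v).pow 2).congr_fderiv ?_
    ext a
    simp
    ring
  have h3 : fderiv ℝ (fun v : 𝔼 => (‖v - v₀‖ ^ 2) ^ 2) =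
      fun v => (4 * ‖v - v₀‖ ^ 2) • innerSL ℝ (v - v₀) := funext fun v => (h2 v).fderiv
  refine ⟨by rw [h3]; simp, ?_⟩
  have h4 : HasFDerivAt (fun v : 𝔼 => (4 * ‖v - v₀‖ ^ 2) • innerSL ℝ (v - v₀)) _ v₀ :=
    ((h1 v₀).const_mul 4).smul
      ((innerSL ℝ (E := 𝔼)).hasFDerivAt.comp v₀ ((hasFDerivAt_id v₀).sub_const v₀))
  rw [h3, h4.fderiv]
  ext a b
  simp

variable [IsContMDiffRiemannianBundle (𝓡 n) ∞ (EuclideanSpace ℝ (Fin n))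
      (fun x : M => TangentSpace (𝓡 n) x)]

theorem chartOperator_add_const (F : Nonlinearity n M) (c : M) (φ : ℝ → M → ℝ) (κ : ℝ)
    (z : ℝ × M) (r : ℝ) :
    chartOperator F c (fun s y => φ s y + κ) z r = chartOperator F c φ z r := by
  have h1 : ∀ t, fderiv ℝ (chartFun (n := n) c (fun s y => φ s y + κ) t) =
      fderiv ℝ (chartFun c φ t) := fun t => funext fun v => fderiv_add_const κ
  simp only [chartOperator, h1, deriv_add_const]

/-- Adding a multiple of `quartic` makes a contact strict and leaves the operator at the contact
point unchanged. -/
theorem chartOperator_add_quartic {F : Nonlinearity n M} {φ : ℝ → M → ℝ} {U : Set (ℝ × M)}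
    (hφ : IsC12On n φ U) (hU : IsOpen U) (hUc : ∀ q ∈ U, q.2 ∈ (extChartAt (𝓡 n) c).source)
    (hz : z ∈ U) (σ r : ℝ) :
    chartOperator F c (fun s y => φ s y + σ * quartic (n := n) c z s y) z r =
      chartOperator F c φ z r := by
  have hq : IsC12On n (fun s y => σ * quartic (n := n) c z s y) U :=
    (IsC12On.smul_quartic σ).mono hUc
  have hzc := hUc z hz
  have hmem := mem_chartRegion hz hzc
  have ev : chartFun c (fun s y => σ * quartic (n := n) c z s y) z.1 =ᶠ[𝓝 (extChartAt (𝓡 n) c z.2)]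
      fun v => σ * (‖v - extChartAt (𝓡 n) c z.2‖ ^ 2) ^ 2 := by
    filter_upwards [(isOpen_extChartAt_target c).mem_nhds ((extChartAt (𝓡 n) c).map_source hzc)]
      with v hv
    simp only [chartFun, quartic, (extChartAt (𝓡 n) c).right_inv hv, sub_self]
    ring
  have hg : ContDiff ℝ ∞ (fun v : 𝔼 => (‖v - extChartAt (𝓡 n) c z.2‖ ^ 2) ^ 2) :=
    (((contDiff_id.sub contDiff_const).norm_sq ℝ).pow 2)
  have hD : fderiv ℝ (fun v : 𝔼 => σ * (‖v - extChartAt (𝓡 n) c z.2‖ ^ 2) ^ 2) =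
      fun v => σ • fderiv ℝ (fun v : 𝔼 => (‖v - extChartAt (𝓡 n) c z.2‖ ^ 2) ^ 2) v :=
    funext fun v => fderiv_const_mul (hg.differentiable (by simp) v) σ
  obtain ⟨f1, f2⟩ := fderiv_norm_sub_pow_four (extChartAt (𝓡 n) c z.2)
  have hg' : DifferentiableAt ℝ (fderiv ℝ (fun v : 𝔼 => (‖v - extChartAt (𝓡 n) c z.2‖ ^ 2) ^ 2))
      (extChartAt (𝓡 n) c z.2) :=
    (hg.fderiv_right (m := ∞) (by simp)).differentiable (by simp) _
  have d1 : fderiv ℝ (chartFun c (fun s y => σ * quartic (n := n) c z s y) z.1)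
      (extChartAt (𝓡 n) c z.2) = 0 := by
    rw [ev.fderiv_eq, hD]
    simp only [f1, smul_zero]
  have d2 : fderiv ℝ (fderiv ℝ (chartFun c (fun s y => σ * quartic (n := n) c z s y) z.1))
      (extChartAt (𝓡 n) c z.2) = 0 := by
    rw [ev.fderiv.fderiv_eq, hD, fderiv_fun_const_smul hg', f2, smul_zero]
  have e1 := (hφ.eventually_fderiv_add hq hU hmem).eq_of_nhds
  have e2 := hφ.fderiv_fderiv_add hq hU hmem
  have e3 : deriv (fun s => φ s z.2 + σ * quartic (n := n) c z s z.2) z.1 =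
      deriv (fun s => φ s z.2) z.1 := by
    rw [deriv_fun_add (hφ.differentiableAt_time hz) (hq.differentiableAt_time hz),
      (hasDerivAt_smul_quartic σ).deriv, add_zero]
  simp only at e1 e2
  rw [Pi.add_apply, d1, add_zero] at e1
  rw [d2, add_zero] at e2
  simp only [chartOperator, e1, e2, e3]

end Perturbation

section Tests

variable [IsContMDiffRiemannianBundle (𝓡 n) ∞ (EuclideanSpace ℝ (Fin n))
      (fun x : M => TangentSpace (𝓡 n) x)]
  {T : ℝ} {Ω : Set M} {F : Nonlinearity n M} {h : ℝ → M → ℝ} {ψ : M → ℝ} {u : ℝ → M → ℝ}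

theorem exists_isJetOf {φ : ℝ → M → ℝ} {U : Set (ℝ × M)} (hφ : IsC12On n φ U) (hU : IsOpen U)
    {z : ℝ × M} (hz : z ∈ U) :
    ∃ j : ℝ × Covector n z.2 × BilinForm n z.2, IsJetOf φ z.1 z.2 j.1 j.2.1 j.2.2 :=
  ⟨(_, _, _), (isJetOf_iff hφ hU hz (mem_extChartAt_source z.2)).2 ⟨rfl, rfl, rfl⟩⟩

theorem IsViscositySubsolution.chartOperator_le (hu : IsViscositySubsolution T Ω F h ψ u)
    {z : ℝ × M} (ht : z.1 ∈ Ioo 0 T) (hx : z.2 ∈ Ω) {φ : ℝ → M → ℝ} {U : Set (ℝ × M)}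
    (hφ : IsC12On n φ U) (hU : IsOpen U) (hz : z ∈ U) {c : M}
    (hc : z.2 ∈ (extChartAt (𝓡 n) c).source) (heq : u z.1 z.2 = φ z.1 z.2)
    (hle : ∀ᶠ q : ℝ × M in 𝓝 z, u q.1 q.2 ≤ φ q.1 q.2) :
    chartOperator F c φ z (u z.1 z.2) ≤ 0 := by
  obtain ⟨j, hj⟩ := exists_isJetOf hφ hU hz
  have h1 := hu.equation z.1 ht z.2 hx j ⟨φ, U, hU, hz, hφ, heq, hle, hj⟩
  rwa [hj.eq_chartOperator F hφ hU hz hc] at h1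

/-- The inequality for the jets follows from the inequality for the coordinate expression of the
operator, where the chart may be chosen for each test function. -/
theorem subsolution_equation_of_chartOperator {z : ℝ × M}
    (hop : ∀ (φ : ℝ → M → ℝ) (U : Set (ℝ × M)), IsC12On n φ U → IsOpen U → z ∈ U →
      u z.1 z.2 = φ z.1 z.2 → (∀ᶠ q : ℝ × M in 𝓝 z, u q.1 q.2 ≤ φ q.1 q.2) →
      ∃ c : M, z.2 ∈ (extChartAt (𝓡 n) c).source ∧ chartOperator F c φ z (u z.1 z.2) ≤ 0)
    (j : ℝ × Covector n z.2 × BilinForm n z.2) (hj : j ∈ superjet n u z.1 z.2) :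
    j.1 + F z.1 z.2 (u z.1 z.2) j.2.1 j.2.2 ≤ 0 := by
  obtain ⟨φ, U, hU, hz, hφ, heq, hle, hjet⟩ := hj
  obtain ⟨c, hc, hle'⟩ := hop φ U hφ hU hz heq hle
  rwa [hjet.eq_chartOperator F hφ hU hz hc]

theorem supersolution_equation_of_chartOperator {z : ℝ × M}
    (hop : ∀ (φ : ℝ → M → ℝ) (U : Set (ℝ × M)), IsC12On n φ U → IsOpen U → z ∈ U →
      u z.1 z.2 = φ z.1 z.2 → (∀ᶠ q : ℝ × M in 𝓝 z, φ q.1 q.2 ≤ u q.1 q.2) →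
      ∃ c : M, z.2 ∈ (extChartAt (𝓡 n) c).source ∧ 0 ≤ chartOperator F c φ z (u z.1 z.2))
    (j : ℝ × Covector n z.2 × BilinForm n z.2) (hj : j ∈ subjet n u z.1 z.2) :
    0 ≤ j.1 + F z.1 z.2 (u z.1 z.2) j.2.1 j.2.2 := by
  obtain ⟨φ, U, hU, hz, hφ, heq, hle, hjet⟩ := hj
  obtain ⟨c, hc, hle'⟩ := hop φ U hφ hU hz heq hle
  rwa [hjet.eq_chartOperator F hφ hU hz hc]

end Tests

/-! ### Barriers that depend on time only -/

section Barrier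

variable [IsContMDiffRiemannianBundle (𝓡 n) ∞ (EuclideanSpace ℝ (Fin n))
      (fun x : M => TangentSpace (𝓡 n) x)]
  {T : ℝ} {Ω : Set M} {F : Nonlinearity n M} {h : ℝ → M → ℝ} {ψ : M → ℝ}

theorem continuousOn_nonlinearity_zero (hF : IsContinuousNonlinearity T F) (r : ℝ) :
    ContinuousOn (fun q : ℝ × M => F q.1 q.2 r 0 0) (Icc 0 T ×ˢ univ) := by
  intro q hq
  have h1 := (continuousOn_chartNonlinearity hF q.2).comp
    (f := fun p : ℝ × M => (p.1, p.2, r, (0 : 𝔼 →L[ℝ] ℝ), (0 : 𝔼 →L[ℝ] 𝔼 →L[ℝ] ℝ)))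
    (s := Icc 0 T ×ˢ (extChartAt (𝓡 n) q.2).source) (by fun_prop)
    fun p hp => ⟨hp.1, hp.2, fun a b => rfl⟩
  have h2 := h1 q ⟨hq.1, mem_extChartAt_source q.2⟩
  simp only [Function.comp_def, chartNonlinearity_zero] at h2
  refine h2.mono_of_mem_nhdsWithin ?_
  exact mem_nhdsWithin.2 ⟨univ ×ˢ (extChartAt (𝓡 n) q.2).source,
    isOpen_univ.prod (isOpen_extChartAt_source q.2), ⟨trivial, mem_extChartAt_source q.2⟩,
    fun p hp => ⟨hp.2.1, hp.1.2⟩⟩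

theorem fderiv_chartFun_const (c : M) (a t : ℝ) (v : 𝔼) :
    fderiv ℝ (chartFun c (fun _ _ => a) t) v = 0 ∧
      fderiv ℝ (fderiv ℝ (chartFun c (fun _ _ => a) t)) v = 0 := by
  have h0 : fderiv ℝ (chartFun (n := n) c (fun _ _ => a) t) = fun _ => 0 :=
    funext fun v => (hasFDerivAt_const a v).fderiv
  rw [h0]
  exact ⟨rfl, (hasFDerivAt_const (0 : 𝔼 →L[ℝ] ℝ) v).fderiv⟩

/-- A function of time that is lower semicontinuous, increases at least at the speed `C`, bounds
the data and is nonnegative is a supersolution, if `C` bounds `F(t, x, 0, 0, 0)`. -/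
theorem isViscositySupersolution_of_time (hFp : IsProperNonlinearity T F) {C : ℝ} {v : ℝ → ℝ}
    (hC : ∀ t ∈ Icc 0 T, ∀ x ∈ closure Ω, -C ≤ F t x 0 0 0) (hv0 : ∀ t ∈ Ico 0 T, 0 ≤ v t)
    (hlsc : LowerSemicontinuousOn v (Ico 0 T))
    (hmono : ∀ s t, s ≤ t → t < T → v s ≤ v t + C * (s - t))
    (hh : ∀ t ∈ Ico 0 T, ∀ x ∈ frontier Ω, h t x ≤ v t) (hψ : ∀ x ∈ closure Ω, ψ x ≤ v 0) :
    IsViscositySupersolution T Ω F h ψ (fun t _ => v t) where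
  lsc := fun q hq a ha => by
    have h1 := hlsc q.1 hq.1 a ha
    exact (continuous_fst.continuousWithinAt.tendsto_nhdsWithin fun p hp => hp.1).eventually h1
  boundary := hh
  initial := hψ
  equation := fun t ht x hx => by
    refine supersolution_equation_of_chartOperator (z := (t, x)) (u := fun t _ => v t)
      fun φ U hφ hU hz heq hle => ⟨x, mem_extChartAt_source x, ?_⟩
    simp only at heq hle
    have h1 : C ≤ deriv (fun s => φ s x) t := by
      refine le_deriv_of_eventually_le (hφ.differentiableAt_time hz) ?_
      filter_upwards [self_mem_nhdsWithin, nhdsWithin_le_nhds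
        ((Continuous.prodMk_left x).continuousAt.eventually hle)] with s hs hs'
      have h2 := hmono s t (le_of_lt hs) ht.2
      linarith
    have h2 := chartNonlinearity_le_of_touching hFp.1 (z := (t, x)) ht hφ
      (IsC12On.const (v t) U) hU hz (mem_extChartAt_source x) heq.symm (by
        filter_upwards [(Continuous.prodMk_right t).continuousAt.eventually hle] with y hy
        exact hy) (v t)
    obtain ⟨c1, c2⟩ := fderiv_chartFun_const (n := n) x (v t) t (extChartAt (𝓡 n) x x)
    simp only [c1, c2, chartNonlinearity_zero] at h2
    have h3 := hFp.2 t ht x 0 0 (fun _ _ => rfl) 0 (v t) (hv0 t ⟨ht.1.le, ht.2⟩)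
    have h4 := hC t ⟨ht.1.le, ht.2.le⟩ x (subset_closure hx)
    simp only [chartOperator]
    linarith

/-- The counterpart of `isViscositySupersolution_of_time` for subsolutions. -/
theorem isViscositySubsolution_of_time (hFp : IsProperNonlinearity T F) {C : ℝ} {v : ℝ → ℝ}
    (hC : ∀ t ∈ Icc 0 T, ∀ x ∈ closure Ω, F t x 0 0 0 ≤ C) (hv0 : ∀ t ∈ Ico 0 T, 0 ≤ v t)
    (hlsc : LowerSemicontinuousOn v (Ico 0 T))
    (hmono : ∀ s t, s ≤ t → t < T → v s ≤ v t + C * (s - t))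
    (hh : ∀ t ∈ Ico 0 T, ∀ x ∈ frontier Ω, -v t ≤ h t x) (hψ : ∀ x ∈ closure Ω, -v 0 ≤ ψ x) :
    IsViscositySubsolution T Ω F h ψ (fun t _ => -v t) where
  usc := fun q hq a ha => by
    have h1 := hlsc q.1 hq.1 (-a) (by simp only at ha; linarith)
    filter_upwards [(continuous_fst.continuousWithinAt.tendsto_nhdsWithin
      fun p hp => hp.1).eventually h1] with p hp
    linarith
  boundary := hh
  initial := hψ
  equation := fun t ht x hx => by
    refine subsolution_equation_of_chartOperator (z := (t, x)) (u := fun t _ => -v t)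
      fun φ U hφ hU hz heq hle => ⟨x, mem_extChartAt_source x, ?_⟩
    simp only at heq hle
    have h1 : deriv (fun s => φ s x) t ≤ -C := by
      refine deriv_le_of_eventually_ge (hφ.differentiableAt_time hz) ?_
      filter_upwards [self_mem_nhdsWithin, nhdsWithin_le_nhds
        ((Continuous.prodMk_left x).continuousAt.eventually hle)] with s hs hs'
      have h2 := hmono s t (le_of_lt hs) ht.2
      linarith
    have h2 := chartNonlinearity_le_of_touching hFp.1 (z := (t, x)) ht
      (IsC12On.const (-v t) U) hφ hU hz (mem_extChartAt_source x) heq (by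
        filter_upwards [(Continuous.prodMk_right t).continuousAt.eventually hle] with y hy
        exact hy) (-v t)
    obtain ⟨c1, c2⟩ := fderiv_chartFun_const (n := n) x (-v t) t (extChartAt (𝓡 n) x x)
    simp only [c1, c2, chartNonlinearity_zero] at h2
    have h3 := hFp.2 t ht x 0 0 (fun _ _ => rfl) (-v t) 0 (by linarith [hv0 t ⟨ht.1.le, ht.2⟩])
    have h4 := hC t ⟨ht.1.le, ht.2.le⟩ x (subset_closure hx)
    simp only [chartOperator]
    linarith

/-- A function that is bounded on each `[0, s] × K` with `s < T` is bounded by a function of time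
which is lower semicontinuous and increases at least at the speed `C`. A nondecreasing step function
with left-continuous jumps at times accumulating at `T` does it. -/
theorem exists_time_bound {K : Set M} (hT : 0 < T) {C b₀ : ℝ} (hC : 0 ≤ C)
    (hb : ∀ s < T, ∃ b, ∀ t ∈ Icc 0 s, ∀ x ∈ K, |h t x| ≤ b) :
    ∃ v : ℝ → ℝ, (∀ t ∈ Ico 0 T, 0 ≤ v t) ∧ LowerSemicontinuousOn v (Ico 0 T) ∧
      (∀ s t, s ≤ t → t < T → v s ≤ v t + C * (s - t)) ∧
      (∀ t ∈ Ico 0 T, ∀ x ∈ K, |h t x| ≤ v t) ∧ b₀ ≤ v 0 := by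
  choose! b hb using hb
  set τ : ℕ → ℝ := fun j => T - T / (j + 1) with hτ
  have hτT : ∀ j, τ j < T := fun j => by
    have : 0 < T / ((j : ℝ) + 1) := by positivity
    simp only [hτ]
    linarith
  set B : ℕ → ℝ := fun j => |b₀| + ∑ i ∈ Finset.range (j + 1), |b (τ i)| with hB
  have hBmono : Monotone B := fun i j hij => by
    simp only [hB]
    gcongr
  have hB0 : ∀ j, |b₀| ≤ B j := fun j => by
    simp only [hB]
    linarith [Finset.sum_nonneg fun i (_ : i ∈ Finset.range (j + 1)) => abs_nonneg (b (τ i))]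
  have hBb : ∀ j, b (τ j) ≤ B j := fun j => by
    have h1 : |b (τ j)| ≤ ∑ i ∈ Finset.range (j + 1), |b (τ i)| :=
      Finset.single_le_sum (f := fun i => |b (τ i)|) (fun i _ => abs_nonneg _)
        (Finset.self_mem_range_succ j)
    simp only [hB]
    linarith [le_abs_self (b (τ j)), abs_nonneg b₀]
  set m : ℝ → ℕ := fun t => ⌈T / (T - t)⌉₊ with hm
  have hmmono : ∀ s t, s ≤ t → t < T → m s ≤ m t := fun s t hst ht => by
    refine Nat.ceil_mono ?_
    have : 0 < T - t := by linarith
    gcongr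
  refine ⟨fun t => B (m t) + C * t, fun t ht => ?_, fun t ht a ha => ?_, fun s t hst ht => ?_,
    fun t ht x hx => ?_, ?_⟩
  · have := mul_nonneg hC ht.1
    linarith [hB0 (m t), abs_nonneg b₀]
  · have h1 : ∀ᶠ s in 𝓝 t, m t ≤ m s := by
      have hcont : ContinuousAt (fun s => T / (T - s)) t :=
        continuousAt_const.div (continuousAt_const.sub continuousAt_id) (by linarith [ht.2])
      rcases Nat.eq_zero_or_pos (m t) with h0 | h0
      · exact Eventually.of_forall fun s => by omega
      have h2 : ((m t - 1 : ℕ) : ℝ) < T / (T - t) := Nat.lt_ceil.1 (Nat.sub_one_lt_of_lt h0)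
      filter_upwards [hcont.eventually (lt_mem_nhds h2)] with s hs
      have := Nat.lt_ceil.2 hs
      simp only [hm] at this ⊢
      omega
    have h2 : ∀ᶠ s in 𝓝 t, a < B (m t) + C * s := by
      have hcont : ContinuousAt (fun s => B (m t) + C * s) t := by fun_prop
      exact hcont.eventually (lt_mem_nhds ha)
    filter_upwards [mem_nhdsWithin_of_mem_nhds h1, mem_nhdsWithin_of_mem_nhds h2] with s hs1 hs2
    linarith [hBmono hs1]
  · simp only
    linarith [hBmono (hmmono s t hst ht)]
  · have hpos : 0 < T - t := by linarith [ht.2]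
    have h1 : T / (T - t) ≤ m t := Nat.le_ceil _
    have h2 : t ≤ τ (m t) := by
      have h3 : T ≤ (m t + 1 : ℝ) * (T - t) := by
        rw [div_le_iff₀ hpos] at h1
        linarith
      have h4 : T / (m t + 1 : ℝ) ≤ T - t := by
        rw [div_le_iff₀ (by positivity)]
        linarith
      simp only [hτ]
      linarith
    have h5 := hb (τ (m t)) (hτT _) t ⟨ht.1, h2⟩ x hx
    have := mul_nonneg hC ht.1
    linarith [hBb (m t)]
  · simp only [mul_zero, add_zero]
    exact (le_abs_self b₀).trans (hB0 _)

/-- There are a supersolution and a subsolution that are locally bounded functions of time. -/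
theorem exists_barrier (hT : 0 < T) (hK : IsCompact (closure Ω))
    (hFc : IsContinuousNonlinearity T F) (hFp : IsProperNonlinearity T F)
    (hh : ContinuousOn (fun q : ℝ × M => h q.1 q.2) (spaceTime T Ω))
    (hψ : ContinuousOn ψ (closure Ω)) :
    ∃ v : ℝ → ℝ, (∀ s t, s ≤ t → t < T → v s ≤ v t) ∧
      IsViscositySupersolution T Ω F h ψ (fun t _ => v t) ∧
      IsViscositySubsolution T Ω F h ψ (fun t _ => -v t) := by
  obtain ⟨C, hC⟩ := (isCompact_Icc.prod hK).exists_bound_of_continuousOn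
    ((continuousOn_nonlinearity_zero hFc 0).mono (prod_mono_right (subset_univ (closure Ω))))
  obtain ⟨b₀, hb₀⟩ := hK.exists_bound_of_continuousOn hψ
  have hC' : ∀ t ∈ Icc 0 T, ∀ x ∈ closure Ω, |F t x 0 0 0| ≤ |C| := fun t ht x hx =>
    (hC (t, x) ⟨ht, hx⟩).trans (le_abs_self C)
  obtain ⟨v, hv0, hlsc, hmono, hvh, hvb⟩ := exists_time_bound (h := h) (K := closure Ω) (b₀ := b₀)
    hT (abs_nonneg C) fun s hs => by
      obtain ⟨b, hb⟩ := (isCompact_Icc.prod hK).exists_bound_of_continuousOn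
        (hh.mono (prod_mono_left fun t ht => ⟨ht.1, ht.2.trans_lt hs⟩ :
          Icc 0 s ×ˢ closure Ω ⊆ spaceTime T Ω))
      exact ⟨b, fun t ht x hx => hb (t, x) ⟨ht, hx⟩⟩
  refine ⟨v, fun s t hst ht => ?_, ?_, ?_⟩
  · have := mul_nonneg (abs_nonneg C) (sub_nonneg.2 hst)
    linarith [hmono s t hst ht]
  · exact isViscositySupersolution_of_time hFp
      (fun t ht x hx => (abs_le.1 (hC' t ht x hx)).1) hv0 hlsc hmono
      (fun t ht x hx => (abs_le.1 (hvh t ht x (frontier_subset_closure hx))).2)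
      fun x hx => ((abs_le.1 (hb₀ x hx)).2).trans hvb
  · exact isViscositySubsolution_of_time hFp
      (fun t ht x hx => (abs_le.1 (hC' t ht x hx)).2) hv0 hlsc hmono
      (fun t ht x hx => (abs_le.1 (hvh t ht x (frontier_subset_closure hx))).1)
      fun x hx => by linarith [(abs_le.1 (hb₀ x hx)).1]

end Barrier

/-! ### Suprema of subsolutions and the bump construction -/

section Perron

variable [IsContMDiffRiemannianBundle (𝓡 n) ∞ (EuclideanSpace ℝ (Fin n))
      (fun x : M => TangentSpace (𝓡 n) x)]
  {T : ℝ} {Ω : Set M} {F : Nonlinearity n M} {h : ℝ → M → ℝ} {ψ : M → ℝ} {u : ℝ → M → ℝ}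

theorem Ioo_prod_subset_spaceTime (T : ℝ) (Ω : Set M) : Ioo 0 T ×ˢ Ω ⊆ spaceTime T Ω :=
  fun _ hq => ⟨⟨hq.1.1.le, hq.1.2⟩, subset_closure hq.2⟩

theorem spaceTime_mem_nhds (hΩ : IsOpen Ω) {z : ℝ × M} (hz : z ∈ Ioo 0 T ×ˢ Ω) :
    spaceTime T Ω ∈ 𝓝 z :=
  mem_of_superset ((isOpen_Ioo.prod hΩ).mem_nhds hz) (Ioo_prod_subset_spaceTime T Ω)

/-- The continuity of the operator of a test function, uniformly in values `r` close to `r₀`. -/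
theorem eventually_chartOperator_mem (hFc : IsContinuousNonlinearity T F) {φ : ℝ → M → ℝ}
    {U : Set (ℝ × M)} (hφ : IsC12On n φ U) (hU : IsOpen U) {z : ℝ × M} (hz : z ∈ U)
    (ht : z.1 ∈ Ioo 0 T) {c : M} (hc : z.2 ∈ (extChartAt (𝓡 n) c).source) (r₀ : ℝ) {s : Set ℝ}
    (hs : s ∈ 𝓝 (chartOperator F c φ z r₀)) :
    ∃ ε > 0, ∀ᶠ q in 𝓝 z, ∀ r, |r - r₀| < ε → chartOperator F c φ q r ∈ s := by
  have hmem : {q : (ℝ × M) × ℝ | q.1 ∈ U ∧ q.1.1 ∈ Icc 0 T ∧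
      q.1.2 ∈ (extChartAt (𝓡 n) c).source} ∈ 𝓝 (z, r₀) := by
    have h1 : ∀ᶠ q : ℝ × M in 𝓝 z, q ∈ U ∧ q.1 ∈ Icc 0 T ∧
        q.2 ∈ (extChartAt (𝓡 n) c).source :=
      (hU.eventually_mem hz).and
        ((continuous_fst.continuousAt.eventually (Icc_mem_nhds ht.1 ht.2)).and
          (continuous_snd.continuousAt.eventually ((isOpen_extChartAt_source c).mem_nhds hc)))
    exact (continuous_fst.tendsto (z, r₀)).eventually h1
  have hev := ((continuousOn_chartOperator (c := c) hFc hφ hU).continuousAt hmem).eventually hs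
  rw [nhds_prod_eq, eventually_prod_iff] at hev
  obtain ⟨pa, hpa, pb, hpb, hab⟩ := hev
  obtain ⟨ε, hε, hball⟩ := Metric.eventually_nhds_iff.1 hpb
  exact ⟨ε, hε, hpa.mono fun q hq r hr => hab hq (hball hr)⟩

theorem isC12On_add_quartic {φ : ℝ → M → ℝ} {U : Set (ℝ × M)} (hφ : IsC12On n φ U) (hU : IsOpen U)
    {c : M} (hUc : ∀ q ∈ U, q.2 ∈ (extChartAt (𝓡 n) c).source) (z : ℝ × M) (σ : ℝ) :
    IsC12On n (fun s y => φ s y + σ * quartic (n := n) c z s y) U :=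
  hφ.add ((IsC12On.smul_quartic σ).mono hUc) hU

theorem continuousOn_quartic {U : Set (ℝ × M)} (hU : IsOpen U)
    {c : M} (hUc : ∀ q ∈ U, q.2 ∈ (extChartAt (𝓡 n) c).source) (z : ℝ × M) :
    ContinuousOn (fun q : ℝ × M => quartic (n := n) c z q.1 q.2) U := by
  simpa using (((IsC12On.smul_quartic (z := z) (1 : ℝ)).mono hUc).continuousOn hU :
    ContinuousOn (fun q : ℝ × M => (1 : ℝ) * quartic (n := n) c z q.1 q.2) U)

/-- The supremum of a family of subsolutions satisfies the subsolution inequality: a function that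
touches its upper envelope strictly from above at `z₀` touches, up to a constant, members of the
family at points close to `z₀`. -/
theorem chartOperator_le_of_isSup [LocallyCompactSpace M] (hΩ : IsOpen Ω)
    (hFc : IsContinuousNonlinearity T F) {S : Set (ℝ → M → ℝ)}
    (hS : ∀ w ∈ S, IsViscositySubsolution T Ω F h ψ w) {V : ℝ → M → ℝ} {z₀ : ℝ × M}
    (hz₀ : z₀ ∈ Ioo 0 T ×ˢ Ω)
    (hle : ∀ w ∈ S, ∀ q ∈ spaceTime T Ω, w q.1 q.2 ≤ V q.1 q.2)
    (hfreq : ∀ a < V z₀.1 z₀.2, ∃ᶠ q : ℝ × M in 𝓝 z₀, ∃ w ∈ S, a < w q.1 q.2)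
    {c : M} (hcz : z₀.2 ∈ (extChartAt (𝓡 n) c).source)
    {φ : ℝ → M → ℝ} {U : Set (ℝ × M)} (hφ : IsC12On n φ U) (hU : IsOpen U) (hz : z₀ ∈ U)
    (heq : V z₀.1 z₀.2 = φ z₀.1 z₀.2)
    (hVφ : ∀ᶠ q : ℝ × M in 𝓝 z₀, V q.1 q.2 ≤ φ q.1 q.2) :
    chartOperator F c φ z₀ (V z₀.1 z₀.2) ≤ 0 := by
  by_contra! hpos
  set U' : Set (ℝ × M) := U ∩ {q | q.2 ∈ (extChartAt (𝓡 n) c).source} with hU'def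
  have hU' : IsOpen U' := hU.inter ((isOpen_extChartAt_source c).preimage continuous_snd)
  have hU'c : ∀ q ∈ U', q.2 ∈ (extChartAt (𝓡 n) c).source := fun q hq => hq.2
  have hzU' : z₀ ∈ U' := ⟨hz, hcz⟩
  have hφ' : IsC12On n φ U' := hφ.mono inter_subset_left
  -- Make the contact at `z₀` strict.
  set η : ℝ × M → ℝ := fun q => quartic (n := n) c z₀ q.1 q.2 with hη
  set φ' : ℝ → M → ℝ := fun s y => φ s y + 1 * quartic (n := n) c z₀ s y with hφ'def
  have hφ'C : IsC12On n φ' U' := isC12On_add_quartic hφ' hU' hU'c z₀ 1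
  have hop : 0 < chartOperator F c φ' z₀ (V z₀.1 z₀.2) := by
    rwa [chartOperator_add_quartic hφ' hU' hU'c hzU']
  obtain ⟨ε, hε, hev⟩ := eventually_chartOperator_mem hFc hφ'C hU' hzU' hz₀.1 hcz _
    (lt_mem_nhds hop)
  have hφc : ContinuousAt (fun q : ℝ × M => φ q.1 q.2) z₀ :=
    (hφ.continuousOn hU).continuousAt (hU.mem_nhds hz)
  have hηcOn : ContinuousOn η U' := continuousOn_quartic hU' hU'c z₀
  have hηc : ContinuousAt η z₀ := hηcOn.continuousAt (hU'.mem_nhds hzU')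
  have hη0 : η z₀ = 0 := quartic_self
  have hball : ∀ᶠ q : ℝ × M in 𝓝 z₀,
      φ q.1 q.2 ∈ Metric.ball (φ z₀.1 z₀.2) (ε / 2) :=
    hφc.eventually (Metric.ball_mem_nhds _ (half_pos hε))
  obtain ⟨K, hK, hKsub, hKc⟩ := local_compact_nhds (hev.and ((hU'.eventually_mem hzU').and
    (((isOpen_Ioo.prod hΩ).eventually_mem hz₀).and (hVφ.and hball))))
  have hηpos : ∀ q ∈ K \ interior K, 0 < η q := fun q hq =>
    quartic_pos hcz (hU'c q (hKsub hq.1).2.1) fun h0 =>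
      hq.2 (h0 ▸ mem_interior_iff_mem_nhds.2 hK)
  obtain ⟨m, hm, hmle⟩ := (hKc.diff isOpen_interior).exists_forall_le'
    (hηcOn.mono fun q hq => (hKsub hq.1).2.1) hηpos
  -- The bound by `m` excludes maximum points outside the interior of `K`; the bound by `ε / 2`
  -- keeps the value of `w` at the maximum point within `ε` of `V z₀`.
  set θ := min m (ε / 2) with hθ
  have hθ0 : 0 < θ := lt_min hm (half_pos hε)
  -- A member of the family almost attains the envelope at a point close to `z₀`.
  obtain ⟨z₁, ⟨w, hw, hwz₁⟩, hz₁K, hz₁φ, hz₁η⟩ :=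
    ((hfreq (V z₀.1 z₀.2 - θ / 3) (by linarith)).and_eventually
      ((eventually_mem_set.2 (interior_mem_nhds.2 hK)).and
        ((hφc.eventually (gt_mem_nhds (show φ z₀.1 z₀.2 < φ z₀.1 z₀.2 + θ / 3 by linarith))).and
          (hηc.eventually (gt_mem_nhds (show η z₀ < θ / 3 by linarith)))))).exists
  have hKD : K ⊆ spaceTime T Ω := fun q hq => Ioo_prod_subset_spaceTime T Ω (hKsub hq).2.2.1
  have husc : UpperSemicontinuousOn (fun q : ℝ × M => w q.1 q.2 + -φ' q.1 q.2) K := by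
    refine UpperSemicontinuousOn.add (fun q hq => ((hS w hw).usc q (hKD hq)).mono hKD) ?_
    exact ((hφ'C.continuousOn hU').mono fun q hq =>
      (hKsub hq).2.1).neg.upperSemicontinuousOn
  obtain ⟨z, hzK, hmax⟩ := husc.exists_isMaxOn ⟨z₀, mem_of_mem_nhds hK⟩ hKc
  have hz₁K' := interior_subset hz₁K
  have h1 : w z₁.1 z₁.2 + -φ' z₁.1 z₁.2 ≤ w z.1 z.2 + -φ' z.1 z.2 := hmax hz₁K'
  have hφ'q : ∀ q : ℝ × M, φ' q.1 q.2 = φ q.1 q.2 + η q := fun q => by simp [hφ'def, hη]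
  have h2 : -θ < w z.1 z.2 + -φ' z.1 z.2 := by
    rw [hφ'q] at h1
    linarith
  obtain ⟨k1, k2, k3, k4, k5⟩ := hKsub hzK
  rw [mem_ball_iff_norm, Real.norm_eq_abs, abs_lt] at k5
  have hwV := hle w hw z (hKD hzK)
  have hzint : z ∈ interior K := by
    by_contra hnot
    have h3 := hmle z ⟨hzK, hnot⟩
    rw [hφ'q] at h2
    linarith [min_le_left m (ε / 2)]
  have hη0z : 0 ≤ η z := quartic_nonneg _ _
  have hclose : |w z.1 z.2 - V z₀.1 z₀.2| < ε := by
    rw [hφ'q] at h2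
    rw [abs_lt]
    constructor <;> linarith [min_le_right m (ε / 2), k5.1, k5.2]
  have h4 := k1 _ hclose
  -- The function `φ' + κ` touches `w` from above at the maximum point `z`.
  set κ := w z.1 z.2 + -φ' z.1 z.2 with hκ
  have h5 := (hS w hw).chartOperator_le (φ := fun s y => φ' s y + κ) k3.1 k3.2
    (hφ'C.add (IsC12On.const κ U') hU') hU' k2 (hU'c z k2) (by simp only [hκ]; ring) (by
      filter_upwards [mem_interior_iff_mem_nhds.1 hzint] with q hq
      have h6 : w q.1 q.2 + -φ' q.1 q.2 ≤ κ := hmax hq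
      linarith)
  rw [chartOperator_add_const] at h5
  exact absurd h4 (not_lt.2 h5)

/-- Perron's bump: if a function touches the lower bound `V` of a subsolution `W` from below at
`z₀` and is a strict classical subsolution there, then `W` is not the largest subsolution. -/
theorem exists_subsolution_gt [LocallyCompactSpace M] (hΩ : IsOpen Ω)
    (hFc : IsContinuousNonlinearity T F) (hFp : IsProperNonlinearity T F) {W : ℝ → M → ℝ}
    (hW : IsViscositySubsolution T Ω F h ψ W) {V : ℝ → M → ℝ} {z₀ : ℝ × M}
    (hz₀ : z₀ ∈ Ioo 0 T ×ˢ Ω)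
    (hle : ∀ q ∈ spaceTime T Ω, V q.1 q.2 ≤ W q.1 q.2)
    (hfreq : ∀ a, V z₀.1 z₀.2 < a → ∃ᶠ q : ℝ × M in 𝓝 z₀, W q.1 q.2 < a)
    {c : M} (hcz : z₀.2 ∈ (extChartAt (𝓡 n) c).source)
    {φ : ℝ → M → ℝ} {U : Set (ℝ × M)} (hφ : IsC12On n φ U) (hU : IsOpen U) (hz : z₀ ∈ U)
    (heq : V z₀.1 z₀.2 = φ z₀.1 z₀.2)
    (hVφ : ∀ᶠ q : ℝ × M in 𝓝 z₀, φ q.1 q.2 ≤ V q.1 q.2)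
    (hneg : chartOperator F c φ z₀ (V z₀.1 z₀.2) < 0) :
    ∃ w : ℝ → M → ℝ, IsViscositySubsolution T Ω F h ψ w ∧
      (∀ q : ℝ × M, W q.1 q.2 ≤ w q.1 q.2) ∧ ∃ q ∈ spaceTime T Ω, W q.1 q.2 < w q.1 q.2 := by
  set U' : Set (ℝ × M) := U ∩ {q | q.2 ∈ (extChartAt (𝓡 n) c).source} with hU'def
  have hU' : IsOpen U' := hU.inter ((isOpen_extChartAt_source c).preimage continuous_snd)
  have hU'c : ∀ q ∈ U', q.2 ∈ (extChartAt (𝓡 n) c).source := fun q hq => hq.2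
  have hzU' : z₀ ∈ U' := ⟨hz, hcz⟩
  have hφ' : IsC12On n φ U' := hφ.mono inter_subset_left
  set η : ℝ × M → ℝ := fun q => quartic (n := n) c z₀ q.1 q.2 with hη
  set φ' : ℝ → M → ℝ := fun s y => φ s y + (-1) * quartic (n := n) c z₀ s y with hφ'def
  have hφ'q : ∀ q : ℝ × M, φ' q.1 q.2 = φ q.1 q.2 - η q := fun q => by
    simp only [hφ'def, hη]; ring
  have hφ'C : IsC12On n φ' U' := isC12On_add_quartic hφ' hU' hU'c z₀ (-1)
  have hop : chartOperator F c φ' z₀ (V z₀.1 z₀.2) < 0 := by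
    rwa [chartOperator_add_quartic hφ' hU' hU'c hzU']
  obtain ⟨ε, hε, hev⟩ := eventually_chartOperator_mem hFc hφ'C hU' hzU' hz₀.1 hcz _
    (gt_mem_nhds hop)
  have hφ'c : ContinuousAt (fun q : ℝ × M => φ' q.1 q.2) z₀ :=
    (hφ'C.continuousOn hU').continuousAt (hU'.mem_nhds hzU')
  have hηcOn : ContinuousOn η U' := continuousOn_quartic hU' hU'c z₀
  have hη0 : η z₀ = 0 := quartic_self
  have hφ'z : φ' z₀.1 z₀.2 = V z₀.1 z₀.2 := by rw [hφ'q, hη0, heq, sub_zero]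
  have hball : ∀ᶠ q : ℝ × M in 𝓝 z₀,
      φ' q.1 q.2 ∈ Metric.ball (φ' z₀.1 z₀.2) (ε / 2) :=
    hφ'c.eventually (Metric.ball_mem_nhds _ (half_pos hε))
  obtain ⟨K, hK, hKsub, hKc⟩ := local_compact_nhds (hev.and ((hU'.eventually_mem hzU').and
    (((isOpen_Ioo.prod hΩ).eventually_mem hz₀).and (hVφ.and hball))))
  obtain ⟨K₁, hK₁, hK₁sub, hK₁c⟩ := local_compact_nhds (interior_mem_nhds.2 hK)
  have hKD : K ⊆ spaceTime T Ω := fun q hq => Ioo_prod_subset_spaceTime T Ω (hKsub hq).2.2.1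
  have hηpos : ∀ q ∈ K \ interior K₁, 0 < η q := fun q hq =>
    quartic_pos hcz (hU'c q (hKsub hq.1).2.1) fun h0 =>
      hq.2 (h0 ▸ mem_interior_iff_mem_nhds.2 hK₁)
  obtain ⟨m, hm, hmle⟩ := (hKc.diff isOpen_interior).exists_forall_le'
    (hηcOn.mono fun q hq => (hKsub hq.1).2.1) hηpos
  -- The bound by `m` puts the bump below `V` on `K \ K₁`; the bound by `ε / 2` keeps its values
  -- within `ε` of `V z₀`, where it is a strict subsolution.
  set δ := min m (ε / 2) with hδ
  have hδ0 : 0 < δ := lt_min hm (half_pos hε)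
  set P : ℝ → M → ℝ := fun s y => φ' s y + δ with hP
  have hPC : IsC12On n P U' := hφ'C.add (IsC12On.const δ U') hU'
  -- Away from `z₀` the bump lies below `W`, so it can be cut off there.
  have hPW : ∀ q ∈ K, q ∉ K₁ → P q.1 q.2 ≤ W q.1 q.2 := fun q hq hq1 => by
    have h1 := hmle q ⟨hq, fun h2 => hq1 (interior_subset h2)⟩
    have h2 := (hKsub hq).2.2.2.1
    have h3 := hle q (hKD hq)
    simp only [hP, hφ'q]
    linarith [min_le_left m (ε / 2)]
  classical
  set w : ℝ → M → ℝ := fun s y => if (s, y) ∈ K₁ then max (W s y) (P s y) else W s y with hw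
  have hw1 : ∀ q ∈ K, w q.1 q.2 = max (W q.1 q.2) (P q.1 q.2) := fun q hq => by
    by_cases hq1 : q ∈ K₁
    · simp only [hw, if_pos hq1]
    · simp only [hw, if_neg hq1, max_eq_left (hPW q hq hq1)]
  have hw2 : ∀ q : ℝ × M, q ∉ K₁ → w q.1 q.2 = W q.1 q.2 := fun q hq => by
    simp only [hw, if_neg hq]
  have hWw : ∀ q : ℝ × M, W q.1 q.2 ≤ w q.1 q.2 := fun q => by
    by_cases hq1 : q ∈ K₁
    · simp only [hw, if_pos hq1, le_max_left]
    · simp only [hw, if_neg hq1, le_refl]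
  have hK₁int : ∀ q ∈ K₁, q ∈ Ioo 0 T ×ˢ Ω := fun q hq =>
    (hKsub (interior_subset (hK₁sub hq))).2.2.1
  refine ⟨w, ⟨fun q hq => ?_, fun t ht x hx => ?_, fun x hx => ?_, fun t ht x hx => ?_⟩, hWw, ?_⟩
  · by_cases hqK : q ∈ K₁
    · have hqint := hK₁sub hqK
      have hPc : ContinuousAt (fun q : ℝ × M => P q.1 q.2) q :=
        (hPC.continuousOn hU').continuousAt (hU'.mem_nhds (hKsub (interior_subset hqint)).2.1)
      intro a ha
      simp only [hw1 q (interior_subset hqint), max_lt_iff] at ha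
      filter_upwards [hW.usc q hq a ha.1,
        mem_nhdsWithin_of_mem_nhds (hPc.eventually (gt_mem_nhds ha.2)),
        mem_nhdsWithin_of_mem_nhds (isOpen_interior.mem_nhds hqint)] with p hp1 hp2 hp3
      rw [hw1 p (interior_subset hp3)]
      exact max_lt hp1 hp2
    · intro a ha
      simp only [hw2 q hqK] at ha
      filter_upwards [hW.usc q hq a ha,
        mem_nhdsWithin_of_mem_nhds (hK₁c.isClosed.isOpen_compl.mem_nhds hqK)] with p hp1 hp2
      rwa [hw2 p hp2]
  · have hnot : (t, x) ∉ K₁ := fun hmem => by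
      rw [hΩ.frontier_eq] at hx
      exact hx.2 (hK₁int _ hmem).2
    exact (hw2 (t, x) hnot).le.trans (hW.boundary t ht x hx)
  · have hnot : ((0 : ℝ), x) ∉ K₁ := fun hmem => lt_irrefl _ (hK₁int _ hmem).1.1
    exact (hw2 (0, x) hnot).le.trans (hW.initial x hx)
  · refine subsolution_equation_of_chartOperator (z := (t, x)) fun φ₂ U₂ hφ₂ hU₂ hz₂ heq₂ hle₂ => ?_
    by_cases hcase : w t x = W t x
    · refine ⟨x, mem_extChartAt_source x, ?_⟩
      have h1 := hW.chartOperator_le (z := (t, x)) ht hx hφ₂ hU₂ hz₂ (mem_extChartAt_source x)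
        (hcase.symm.trans heq₂) (hle₂.mono fun q hq => (hWw q).trans hq)
      simp only at h1
      simp only [hcase]
      exact h1
    -- Where `w` exceeds `W`, the test function touches the bump from above: ellipticity applies.
    · have hK₁mem : (t, x) ∈ K₁ := by
        by_contra hnot
        exact hcase (hw2 (t, x) hnot)
      have hint := hK₁sub hK₁mem
      obtain ⟨k1, k2, k3, k4, k5⟩ := hKsub (interior_subset hint)
      have hwP : w t x = P t x := by
        have h1 : w t x = max (W t x) (P t x) := hw1 (t, x) (interior_subset hint)
        rcases max_choice (W t x) (P t x) with h2 | h2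
        · exact absurd (h1.trans h2) hcase
        · exact h1.trans h2
      refine ⟨c, hU'c _ k2, ?_⟩
      have h3 := chartOperator_le_of_touching hFp.1 (z := (t, x)) (φ₁ := P) (φ₂ := φ₂)
        (U := U' ∩ U₂) (c := c) ht (hPC.mono inter_subset_left) (hφ₂.mono inter_subset_right)
        (hU'.inter hU₂) ⟨k2, hz₂⟩ (hU'c _ k2) (hwP.symm.trans heq₂) (by
          filter_upwards [hle₂, mem_interior_iff_mem_nhds.1 hint] with q hq1 hq2
          refine le_trans ?_ hq1
          rw [hw1 q hq2]
          exact le_max_right _ _) (w t x)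
      rw [chartOperator_add_const] at h3
      refine h3.trans (le_of_lt (k1 _ ?_))
      rw [mem_ball_iff_norm, Real.norm_eq_abs, abs_lt] at k5
      simp only at k5
      rw [hwP, abs_lt]
      simp only [hP]
      constructor <;> linarith [min_le_right m (ε / 2), k5.1, k5.2]
  · obtain ⟨q, hq1, hq2, hq3⟩ := ((hfreq (V z₀.1 z₀.2 + δ / 2) (by linarith)).and_eventually
      ((eventually_mem_set.2 hK₁).and (hφ'c.eventually
        (lt_mem_nhds (show φ' z₀.1 z₀.2 - δ / 2 < φ' z₀.1 z₀.2 by linarith))))).exists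
    have hqK := interior_subset (hK₁sub hq2)
    refine ⟨q, hKD hqK, ?_⟩
    rw [hw1 q hqK]
    refine lt_max_of_lt_right ?_
    simp only [hP]
    linarith

theorem IsViscositySubsolution.max {u₁ u₂ : ℝ → M → ℝ} (h₁ : IsViscositySubsolution T Ω F h ψ u₁)
    (h₂ : IsViscositySubsolution T Ω F h ψ u₂) :
    IsViscositySubsolution T Ω F h ψ (fun t x => max (u₁ t x) (u₂ t x)) where
  usc := fun q hq a ha => by
    obtain ⟨ha1, ha2⟩ := max_lt_iff.1 ha
    filter_upwards [h₁.usc q hq a ha1, h₂.usc q hq a ha2] with p hp1 hp2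
    exact max_lt hp1 hp2
  boundary := fun t ht x hx => max_le (h₁.boundary t ht x hx) (h₂.boundary t ht x hx)
  initial := fun x hx => max_le (h₁.initial x hx) (h₂.initial x hx)
  equation := fun t ht x hx => by
    refine subsolution_equation_of_chartOperator (z := (t, x))
      (u := fun t x => Max.max (u₁ t x) (u₂ t x))
      fun φ U hφ hU hz heq hle => ⟨x, mem_extChartAt_source x, ?_⟩
    simp only at heq hle ⊢
    rcases max_choice (u₁ t x) (u₂ t x) with hm | hm
    · rw [hm] at heq ⊢
      exact h₁.chartOperator_le (z := (t, x)) ht hx hφ hU hz (mem_extChartAt_source x) heq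
        (hle.mono fun q hq => (le_max_left _ _).trans hq)
    · rw [hm] at heq ⊢
      exact h₂.chartOperator_le (z := (t, x)) ht hx hφ hU hz (mem_extChartAt_source x) heq
        (hle.mono fun q hq => (le_max_right _ _).trans hq)

end Perron

/-! ### Restriction to the parabolic cylinder and local bounds -/

section PerronFunction

variable {T : ℝ} {Ω : Set M} {F : Nonlinearity n M} {h : ℝ → M → ℝ} {ψ : M → ℝ}
  {u u' : ℝ → M → ℝ}

theorem eventuallyEq_of_spaceTime (hΩ : IsOpen Ω)
    (huu' : ∀ q ∈ spaceTime T Ω, u q.1 q.2 = u' q.1 q.2) {t : ℝ} (ht : t ∈ Ioo 0 T) {x : M}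
    (hx : x ∈ Ω) : ∀ᶠ q : ℝ × M in 𝓝 (t, x), u q.1 q.2 = u' q.1 q.2 := by
  filter_upwards [spaceTime_mem_nhds hΩ (show (t, x) ∈ Ioo 0 T ×ˢ Ω from ⟨ht, hx⟩)] with q hq
  exact huu' q hq

theorem IsViscositySubsolution.congr (hΩ : IsOpen Ω) (hu : IsViscositySubsolution T Ω F h ψ u)
    (hT : 0 < T) (huu' : ∀ q ∈ spaceTime T Ω, u q.1 q.2 = u' q.1 q.2) :
    IsViscositySubsolution T Ω F h ψ u' where
  usc := fun q hq a ha => by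
    simp only [← huu' q hq] at ha
    filter_upwards [hu.usc q hq a ha, self_mem_nhdsWithin] with p hp hpD
    rwa [← huu' p hpD]
  boundary := fun t ht x hx =>
    (huu' (t, x) ⟨ht, frontier_subset_closure hx⟩).symm.le.trans (hu.boundary t ht x hx)
  initial := fun x hx => (huu' (0, x) ⟨⟨le_rfl, hT⟩, hx⟩).symm.le.trans (hu.initial x hx)
  equation := fun t ht x hx j hj => by
    have hev := eventuallyEq_of_spaceTime hΩ huu' ht hx
    obtain ⟨φ, U, hU, hz, hφ, heq, hle, hjet⟩ := hj
    have h0 : u t x = u' t x := hev.self_of_nhds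
    rw [← h0]
    refine hu.equation t ht x hx j ⟨φ, U, hU, hz, hφ, h0.trans heq, ?_, hjet⟩
    filter_upwards [hev, hle] with q hq1 hq2 using hq1.le.trans hq2

theorem IsViscositySupersolution.congr (hΩ : IsOpen Ω) (hu : IsViscositySupersolution T Ω F h ψ u)
    (hT : 0 < T) (huu' : ∀ q ∈ spaceTime T Ω, u q.1 q.2 = u' q.1 q.2) :
    IsViscositySupersolution T Ω F h ψ u' where
  lsc := fun q hq a ha => by
    simp only [← huu' q hq] at ha
    filter_upwards [hu.lsc q hq a ha, self_mem_nhdsWithin] with p hp hpD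
    rwa [← huu' p hpD]
  boundary := fun t ht x hx =>
    (hu.boundary t ht x hx).trans (huu' (t, x) ⟨ht, frontier_subset_closure hx⟩).le
  initial := fun x hx => (hu.initial x hx).trans (huu' (0, x) ⟨⟨le_rfl, hT⟩, hx⟩).le
  equation := fun t ht x hx j hj => by
    have hev := eventuallyEq_of_spaceTime hΩ huu' ht hx
    obtain ⟨φ, U, hU, hz, hφ, heq, hle, hjet⟩ := hj
    have h0 : u t x = u' t x := hev.self_of_nhds
    rw [← h0]
    refine hu.equation t ht x hx j ⟨φ, U, hU, hz, hφ, h0.trans heq, ?_, hjet⟩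
    filter_upwards [hev, hle] with q hq1 hq2 using hq2.trans hq1.ge

/-- A bound by a nondecreasing function of time on `[0, T)` is a local bound, since each time before
`T` is followed by a later one. -/
theorem eventually_abs_le_of_time_bound {W : ℝ → M → ℝ} {v : ℝ → ℝ}
    (hv : ∀ s t, s ≤ t → t < T → v s ≤ v t)
    (hWv : ∀ q ∈ spaceTime T Ω, |W q.1 q.2| ≤ v q.1) {z : ℝ × M} (hz : z ∈ spaceTime T Ω) :
    ∃ a, ∀ᶠ q : ℝ × M in 𝓝[spaceTime T Ω] z, |W q.1 q.2| ≤ a := by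
  obtain ⟨t₁, ht₁, ht₁T⟩ := exists_between hz.1.2
  refine ⟨v t₁, ?_⟩
  filter_upwards [mem_nhdsWithin_of_mem_nhds
    (continuous_fst.continuousAt.eventually (gt_mem_nhds ht₁)), self_mem_nhdsWithin] with q hq hqD
  exact (hWv q hqD).trans (hv _ _ hq.le ht₁T)

end PerronFunction

end Charts

end ParabolicViscosity

end

theorem theorem4p1 {n : ℕ} {M : Type*} [MetricSpace M] [CompleteSpace M]
    [ChartedSpace (EuclideanSpace ℝ (Fin n)) M] [IsManifold (𝓡 n) ∞ M]
    [RiemannianBundle (fun x : M => TangentSpace (𝓡 n) x)]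
    [IsContMDiffRiemannianBundle (𝓡 n) ∞ (EuclideanSpace ℝ (Fin n))
      (fun x : M => TangentSpace (𝓡 n) x)]
    [IsRiemannianManifold (𝓡 n) M]
    (T : ℝ) (hT : 0 < T) (Ω : Set M) (hΩ : IsOpen Ω) (hΩb : Bornology.IsBounded Ω)
    (F : ParabolicViscosity.Nonlinearity n M)
    (hFc : ParabolicViscosity.IsContinuousNonlinearity T F)
    (hFp : ParabolicViscosity.IsProperNonlinearity T F)
    (h : ℝ → M → ℝ)
    (hh : ContinuousOn (fun q : ℝ × M => h q.1 q.2) (ParabolicViscosity.spaceTime T Ω))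
    (ψ : M → ℝ) (hψ : ContinuousOn ψ (closure Ω))
    (hcomp : ParabolicViscosity.ComparisonHolds T Ω F h ψ)
    (uLow uUp : ℝ → M → ℝ)
    (hLow : ParabolicViscosity.IsViscositySubsolution T Ω F h ψ uLow)
    (hUp : ParabolicViscosity.IsViscositySupersolution T Ω F h ψ uUp)
    (hinit : ∀ x ∈ closure Ω,
      ParabolicViscosity.lowerEnvelope (ParabolicViscosity.spaceTime T Ω) uLow 0 x = (ψ x : EReal) ∧
      ParabolicViscosity.upperEnvelope (ParabolicViscosity.spaceTime T Ω) uUp 0 x = (ψ x : EReal))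
    (hbdry : ∀ t ∈ Ico 0 T, ∀ x ∈ frontier Ω,
      ParabolicViscosity.lowerEnvelope (ParabolicViscosity.spaceTime T Ω) uLow t x
        = (h t x : EReal) ∧
      ParabolicViscosity.upperEnvelope (ParabolicViscosity.spaceTime T Ω) uUp t x
        = (h t x : EReal)) :
    (∀ t ∈ Ico 0 T, ∀ x ∈ closure Ω,
      IsLUB (ParabolicViscosity.perronValues T Ω F h ψ uLow uUp t x)
        (ParabolicViscosity.perronFunction T Ω F h ψ uLow uUp t x)) ∧
    ParabolicViscosity.IsViscositySolution T Ω F h ψ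
      (ParabolicViscosity.perronFunction T Ω F h ψ uLow uUp) := by
  open ParabolicViscosity in
  have hproper : ProperSpace M := properSpace_of_completeSpace n
  set D := spaceTime T Ω with hD
  set S : Set (ℝ → M → ℝ) := {w | IsViscositySubsolution T Ω F h ψ w ∧
    ∀ q ∈ D, uLow q.1 q.2 ≤ w q.1 q.2 ∧ w q.1 q.2 ≤ uUp q.1 q.2} with hS
  set W := perronFunction T Ω F h ψ uLow uUp with hWdef
  have hlow_up : ∀ q ∈ D, uLow q.1 q.2 ≤ uUp q.1 q.2 := hcomp uLow uUp hLow hUp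
  have hlowS : uLow ∈ S := ⟨hLow, fun q hq => ⟨le_rfl, hlow_up q hq⟩⟩
  have hlub : ∀ q ∈ D, IsLUB (perronValues T Ω F h ψ uLow uUp q.1 q.2) (W q.1 q.2) := fun q hq =>
    isLUB_csSup ⟨uLow q.1 q.2, uLow, hlowS.1, hlowS.2, rfl⟩
      ⟨uUp q.1 q.2, by rintro r ⟨w, -, hw, rfl⟩; exact (hw q hq).2⟩
  have hle : ∀ w ∈ S, ∀ q ∈ D, w q.1 q.2 ≤ W q.1 q.2 := fun w hw q hq =>
    (hlub q hq).1 ⟨w, hw.1, hw.2, rfl⟩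
  have hWle : ∀ q ∈ D, ∀ a, (∀ w ∈ S, w q.1 q.2 ≤ a) → W q.1 q.2 ≤ a := fun q hq a ha =>
    (hlub q hq).2 (by rintro r ⟨w, hw1, hw2, rfl⟩; exact ha w ⟨hw1, hw2⟩)
  have hlowW : ∀ q ∈ D, uLow q.1 q.2 ≤ W q.1 q.2 := hle uLow hlowS
  have hWup : ∀ q ∈ D, W q.1 q.2 ≤ uUp q.1 q.2 := fun q hq =>
    hWle q hq _ fun w hw => (hw.2 q hq).2
  refine ⟨fun t ht x hx => hlub (t, x) ⟨ht, hx⟩, ?_⟩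
  obtain ⟨v, hv, hvsup, hvsub⟩ := exists_barrier hT
    (Metric.isCompact_of_isClosed_isBounded isClosed_closure hΩb.closure) hFc hFp hh hψ
  -- Comparison with the barriers `v` and `-v` shows that `W` is locally bounded.
  have hvS : (fun t x => max (uLow t x) (-v t)) ∈ S :=
    ⟨hLow.max hvsub, fun q hq => ⟨le_max_left _ _,
      max_le (hlow_up q hq) (hcomp _ _ hvsub hUp q hq)⟩⟩
  have hWv : ∀ q ∈ D, |W q.1 q.2| ≤ v q.1 := fun q hq => abs_le.2
    ⟨(le_max_right _ _).trans (hle _ hvS q hq),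
      hWle q hq _ fun w hw => hcomp _ _ hw.1 hvsup q hq⟩
  have hbd : ∀ z ∈ D, ∃ a, ∀ᶠ q : ℝ × M in 𝓝[D] z, |W q.1 q.2| ≤ a := fun z hz =>
    eventually_abs_le_of_time_bound hv hWv hz
  have hbdu : ∀ z ∈ D, ∃ a, ∀ᶠ q : ℝ × M in 𝓝[D] z, W q.1 q.2 ≤ a := fun z hz =>
    (hbd z hz).imp fun a ha => ha.mono fun q hq => (le_abs_self _).trans hq
  have hbdl : ∀ z ∈ D, ∃ a, ∀ᶠ q : ℝ × M in 𝓝[D] z, -W q.1 q.2 ≤ a := fun z hz =>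
    (hbd z hz).imp fun a ha => ha.mono fun q hq => (neg_le_abs _).trans hq
  -- Hence its semicontinuous envelopes are real-valued.
  set Vu : ℝ → M → ℝ := fun t x => upperEnv D (fun q : ℝ × M => W q.1 q.2) (t, x) with hVu
  set Vl : ℝ → M → ℝ := fun t x => -upperEnv D (fun q : ℝ × M => -W q.1 q.2) (t, x) with hVl
  have hWVu : ∀ q ∈ D, W q.1 q.2 ≤ Vu q.1 q.2 := fun q hq => le_upperEnv hq (hbdu q hq)
  have hVlW : ∀ q ∈ D, Vl q.1 q.2 ≤ W q.1 q.2 := fun q hq =>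
    neg_le.1 (le_upperEnv hq (hbdl q hq))
  have hVu_le : ∀ t x b, (t, x) ∈ D → upperEnvelope D uUp t x = ((b : ℝ) : EReal) → Vu t x ≤ b := by
    intro t x b hq hb
    refine le_of_forall_gt_imp_ge_of_dense fun a ha => upperEnv_le hq ?_
    filter_upwards [eventually_le_of_upperEnvelope hb ha, self_mem_nhdsWithin] with p hp hpD
    exact (hWup p hpD).trans hp
  have hle_Vl : ∀ t x b, (t, x) ∈ D → lowerEnvelope D uLow t x = ((b : ℝ) : EReal) →
      b ≤ Vl t x := by
    intro t x b hq hb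
    refine le_of_forall_lt_imp_le_of_dense fun a ha => le_neg.1 (upperEnv_le hq ?_)
    filter_upwards [eventually_le_of_lowerEnvelope hb ha, self_mem_nhdsWithin] with p hp hpD
    exact neg_le_neg (hp.trans (hlowW p hpD))
  have hVuSub : IsViscositySubsolution T Ω F h ψ Vu := by
    refine ⟨upperSemicontinuousOn_upperEnv hbdu, fun t ht x hx => ?_, fun x hx => ?_,
      fun t ht x hx => ?_⟩
    · exact hVu_le t x _ ⟨ht, frontier_subset_closure hx⟩ (hbdry t ht x hx).2
    · exact hVu_le 0 x _ ⟨⟨le_rfl, hT⟩, hx⟩ (hinit x hx).2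
    · have hz : (t, x) ∈ Ioo 0 T ×ˢ Ω := ⟨ht, hx⟩
      refine subsolution_equation_of_chartOperator (z := (t, x)) fun φ U hφ hU hzU heq hleφ =>
        ⟨x, mem_extChartAt_source x, ?_⟩
      refine chartOperator_le_of_isSup (S := S) (h := h) (ψ := ψ) hΩ hFc (fun w hw => hw.1) hz
        (fun w hw q hq => (hle w hw q hq).trans (hWVu q hq)) (fun a ha => ?_)
        (mem_extChartAt_source x) hφ hU hzU heq hleφ
      have h1 := frequently_lt_of_lt_upperEnv (Ioo_prod_subset_spaceTime T Ω hz) ha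
      refine ((h1.and_eventually self_mem_nhdsWithin).filter_mono nhdsWithin_le_nhds).mono ?_
      rintro q ⟨hq, hqD⟩
      by_contra! hcon
      exact hq.not_ge (hWle q hqD a hcon)
  have hVuS : Vu ∈ S := ⟨hVuSub, fun q hq =>
    ⟨(hlowW q hq).trans (hWVu q hq), hcomp _ _ hVuSub hUp q hq⟩⟩
  have hWSub : IsViscositySubsolution T Ω F h ψ W :=
    hVuSub.congr hΩ hT fun q hq => le_antisymm (hle Vu hVuS q hq) (hWVu q hq)
  have hVlSuper : IsViscositySupersolution T Ω F h ψ Vl := by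
    refine ⟨fun q hq a ha => ?_, fun t ht x hx => ?_, fun x hx => ?_, fun t ht x hx => ?_⟩
    · have h1 := upperSemicontinuousOn_upperEnv hbdl q hq (-a) (lt_neg.1 ha)
      exact h1.mono fun p hp => lt_neg.1 hp
    · exact hle_Vl t x _ ⟨ht, frontier_subset_closure hx⟩ (hbdry t ht x hx).1
    · exact hle_Vl 0 x _ ⟨⟨le_rfl, hT⟩, hx⟩ (hinit x hx).1
    · have hz : (t, x) ∈ Ioo 0 T ×ˢ Ω := ⟨ht, hx⟩
      refine supersolution_equation_of_chartOperator (z := (t, x)) fun φ U hφ hU hzU heq hleφ =>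
        ⟨x, mem_extChartAt_source x, ?_⟩
      by_contra! hneg
      -- Otherwise a bump gives a member of the family exceeding its supremum.
      obtain ⟨w, hw, hWw, q, hq, hlt⟩ := exists_subsolution_gt hΩ hFc hFp hWSub hz hVlW
        (fun a ha => by
          have h1 := frequently_lt_of_lt_upperEnv (Ioo_prod_subset_spaceTime T Ω hz) (neg_lt.1 ha)
          exact (h1.filter_mono nhdsWithin_le_nhds).mono fun q hq => neg_lt_neg_iff.1 hq)
        (mem_extChartAt_source x) hφ hU hzU heq hleφ hneg
      have hwS : w ∈ S := ⟨hw, fun p hp =>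
        ⟨(hlowW p hp).trans (hWw p), hcomp _ _ hw hUp p hp⟩⟩
      exact hlt.not_ge (hle w hwS q hq)
  exact ⟨hWSub, hVlSuper.congr hΩ hT fun q hq =>
    le_antisymm (hVlW q hq) (hcomp _ _ hWSub hVlSuper q hq)⟩
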